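/- Write $\lambda$ for the uniform (Lebesgue) product measure on $3^\omega=\{0,1,2\}^{\mathbb N}$. A sequence $x\in 3^\omega$ is (Martin-Löf) random if $x\notin\bigcap_k U_k$ for every uniformly $\Sigma^0_1$ sequence $(U_k)_{k\in\mathbb N}$ of subsets of $3^\omega$ with $\lambda(U_k)\le 2^{-k}$ for all $k$. Let $\sigma_0=\epsilon,\sigma_1=0,\sigma_2=1,\sigma_3=00,\dots$ be the length-lexicographic enumeration of the finite binary strings. For $x\in 3^\omega$ let $F_x$ be the partial function from $2^\omega$ to $2^\omega$ defined as follows: label each non-empty string $\sigma_i$ by $\ell_x(\sigma_i)=x(i-1)$; then $F_x(u)$ is the sequence obtained from $\ell_x(u\restriction 1),\ell_x(u\restriction 2),\ell_x(u\restriction 3),\dots$ by removing all $2$'s, and is undefined if only finitely many digits remain. A *random continuous function* is a partial function $F=F_x$ with $x\in 3^\omega$ random. For $x\in 3^\omega$ let $T_x$ be the binary tree without dead ends such that $\epsilon\in T_x$ and, if $\sigma$ is the $(i+1)$-st node of $T_x$ in length-lexicographic order, then the children of $\sigma$ in $T_x$ are: only $\sigma 0$ if $x(i)=0$, only $\sigma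 1$ if $x(i)=1$, both $\sigma 0$ and $\sigma 1$ if $x(i)=2$. A *random closed set* is a non-empty closed set $C\subseteq 2^\omega$ that equals the set $[T_x]$ of infinite paths through $T_x$ for some random $x\in 3^\omega$. **Corollary.** Let $F$ be a random continuous function. Then $F$ is not injective: there are $u\ne v$ in its domain with $F(u)=F(v)$. Moreover, there is $y\in 2^\omega$ such that the fiber $F^{-1}(\{y\})$ is non-empty, is a random closed set, and is perfect (closed without isolated points). -/

import Mathlib

open MeasureTheory
open scoped ENNReal

/-- The space `n^ω` of infinite sequences over the alphabet `{0, …, n-1}`, with the product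
topology and the product σ-algebra. -/
abbrev InfSeq (n : ℕ) : Type := ℕ → Fin n

/-- `restr x k` is the initial segment of `x` of length `k`. -/
def restr {n : ℕ} (x : InfSeq n) (k : ℕ) : List (Fin n) := (List.range k).map x

/-- Lebesgue measure on `n^ω`: the product of the uniform measures on the alphabet. -/
noncomputable def lebesgue (n : ℕ) [NeZero n] : Measure (InfSeq n) :=
  Measure.infinitePi fun _ : ℕ => (PMF.uniformOfFintype (Fin n)).toMeasure

/-- The open subset of `n^ω` generated by a set of strings: the union of the cylinders of its
members. -/
def openSet {n : ℕ} (W : List (Fin n) → Prop) : Set (InfSeq n) := {x | ∃ k, W (restr x k)}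

/-- A Martin-Löf test for Lebesgue measure: a uniformly `Σ⁰₁` sequence of subsets of `n^ω` whose
`k`-th member has measure at most `2^{-k}`. -/
def IsMLTest {n : ℕ} [NeZero n] (U : ℕ → Set (InfSeq n)) : Prop :=
  (∃ W : ℕ × List (Fin n) → Prop, REPred W ∧ ∀ k, U k = openSet fun σ => W (k, σ)) ∧
    ∀ k, lebesgue n (U k) ≤ (2⁻¹ : ℝ≥0∞) ^ k

/-- `MLR n` is the set of Martin-Löf random elements of `n^ω` (for Lebesgue measure): those that
pass every Martin-Löf test. -/
def MLR (n : ℕ) [NeZero n] : Set (InfSeq n) :=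
  {x | ∀ U : ℕ → Set (InfSeq n), IsMLTest U → x ∉ ⋂ k, U k}

/-- The two children, one or both, that a digit `d ∈ {0, 1, 2}` puts above the node `σ`,
from left to right. -/
def children (σ : List (Fin 2)) (d : Fin 3) : List (List (Fin 2)) :=
  if d = 0 then [σ ++ [0]] else if d = 1 then [σ ++ [1]] else [σ ++ [0], σ ++ [1]]

/-- Breadth-first generation of the tree coded by `x`. After `i` steps the queue holds, in
length-lexicographic order, the nodes generated so far except the first `i` nodes of the tree;
its head is therefore the `(i+1)`-st node, and the digit `x i` decides which children it gets. -/
def treeQueue (x : InfSeq 3) : ℕ → List (List (Fin 2))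
  | 0 => [[]]
  | i + 1 =>
    match treeQueue x i with
    | [] => []
    | σ :: q => q ++ children σ (x i)

/-- The tree `T_x` (without dead ends) coded by `x ∈ 3^ω`: its `(i+1)`-st node is the one treated
at step `i` of the breadth-first generation. -/
def codedTree (x : InfSeq 3) : Set (List (Fin 2)) :=
  {σ | ∃ i, (treeQueue x i).head? = some σ}

/-- The set `[T]` of paths through `T`. -/
def paths (T : Set (List (Fin 2))) : Set (InfSeq 2) := {y | ∀ k, restr y k ∈ T}

/-- A random closed set: a non-empty closed subset of `2^ω` of the form `[T_x]` with `x ∈ 3^ω`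
Martin-Löf random. -/
def IsRandomClosedSet (C : Set (InfSeq 2)) : Prop :=
  C.Nonempty ∧ IsClosed C ∧ ∃ x ∈ MLR 3, C = paths (codedTree x)

/-- The position of a binary string in the length-lexicographic enumeration
`σ₀ = ε, σ₁ = 0, σ₂ = 1, σ₃ = 00, …`: appending the bit `b` to `σ_i` gives `σ_{2i+1+b}`. -/
def stringIndex (σ : List (Fin 2)) : ℕ := σ.foldl (fun i b => 2 * i + 1 + b.val) 0

/-- The label `ℓ_x(σ_i) = x_{i-1}` of the non-empty string `σ_i`. -/
def label (x : InfSeq 3) (σ : List (Fin 2)) : Fin 3 := x (stringIndex σ - 1)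

/-- The sequence `ℓ_x(y↾1), ℓ_x(y↾2), …` of labels along `y`. -/
def labelsAlong (x : InfSeq 3) (y : InfSeq 2) : InfSeq 3 := fun k => label x (restr y (k + 1))

/-- The partial function `F_x` on `2^ω` coded by `x ∈ 3^ω`: `F_x(y)` is what remains of the
sequence of labels along `y` after removing all `2`s, and is undefined if only finitely many
digits remain. (`F_x` is automatically continuous on its domain.) -/
noncomputable def codedFunction (x : InfSeq 3) : InfSeq 2 →. InfSeq 2 := fun y =>
  { Dom := {k | labelsAlong x y k ≠ 2}.Infinite
    get := fun _ n =>
      if labelsAlong x y (Nat.nth (fun k => labelsAlong x y k ≠ 2) n) = 0 then 0 else 1 }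

/-- A random continuous function: a partial function `F` on `2^ω` of the form `F_x` with
`x ∈ 3^ω` Martin-Löf random. -/
def IsRandomContinuousFunction (F : InfSeq 2 →. InfSeq 2) : Prop :=
  ∃ x ∈ MLR 3, F = codedFunction x

/-- Injectivity of a partial function (on its domain). -/
def IsInjectivePartial (F : InfSeq 2 →. InfSeq 2) : Prop :=
  ∀ u v y, y ∈ F u → y ∈ F v → u = v

/-! Fix a computable `y` and call a node consistent if the labels on the way to it, with the `2`s
removed, form an initial segment of `y`. Since `F` is total (`infinite_labelsAlong`), the fiber of
`y` consists of the infinite consistent paths. For uniform labels each child of a consistent node is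
consistent with probability 2/3, independently, so the consistent nodes form a branching process
whose survival probability is the solution s = 3/4 of s = 1 - (1 - 2s/3)^2. A child is thus
consistent and the root of an infinite consistent tree with probability 2/3 · 3/4 = 1/2. The cases
left only, right only, both and none have probability 1/4 each; given survival, the three digits of
the code are equally likely. So, given survival, the code of the tree of surviving nodes is
uniformly distributed (`codeEvent_bound` is the upper bound needed).

Consequently a test that captures the code pulls back to a test that captures `x`, and the code is
random when `x` is (`treeCode_mem_MLR`). Survival is only a co-c.e. event, so the pullback is not
effectively open as it stands. It is replaced by what a finite lookahead shows; the error is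
exponentially small in the lookahead, and its total measure fits into the test
(`lebesgue_misjudged_le`, `lebesgue_apparentCode_le`).

For a non-empty fiber, note that the subtrees hanging off the rightmost path are independent. If `x`
is random, one of them carries an infinite tree consistent with the zero sequence
(`exists_survives`). Take for `y` the digits on the way there, followed by zeros
(`exists_survives_root`). Finally, the code of the tree above any node of a path in the fiber is
random, hence contains the digit `2`, so the tree branches there. This makes the fiber perfect and
refutes injectivity (`exists_ne_matching_path`). -/

namespace FiberTree

/-! ### The tree of consistent nodes, survival, and breadth-first codes. -/

section Trees

/-- Nodes are pairs `(i, c)` of the position `i` of a string in the length-lexicographic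
enumeration and the number `c` of digits of `y` matched so far. The list has the child of `p` in
direction `b` as its only member if the label of that child is `2` or the next digit of `y`, and
is empty otherwise. -/
def childAt (x y : ℕ → Fin 3) (b : ℕ) (p : ℕ × ℕ) : List (ℕ × ℕ) :=
  if x (2 * p.1 + b) = 2 then [(2 * p.1 + 1 + b, p.2)]
  else if x (2 * p.1 + b) = y p.2 then [(2 * p.1 + 1 + b, p.2 + 1)] else []

/-- The children of `p` that are consistent with `y`. -/
def succs (x y : ℕ → Fin 3) (p : ℕ × ℕ) : List (ℕ × ℕ) := childAt x y 0 p ++ childAt x y 1 p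

/-- The consistent descendants, `n` levels up, of the members of a list. -/
def descend (x y : ℕ → Fin 3) (n : ℕ) (l : List (ℕ × ℕ)) : List (ℕ × ℕ) :=
  (fun l => l.flatMap (succs x y))^[n] l

/-- Whether `p` has a consistent descendant `n` levels up. -/
def survives (x y : ℕ → Fin 3) (n : ℕ) (p : ℕ × ℕ) : Bool := !(descend x y n [p]).isEmpty

/-- The tree of consistent nodes above `p` is infinite. -/
def Survives (x y : ℕ → Fin 3) (p : ℕ × ℕ) : Prop := ∀ n, survives x y n p = true

open Classical in
/-- `Survives` as a Boolean function. -/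
noncomputable def immortal (x y : ℕ → Fin 3) (p : ℕ × ℕ) : Bool := decide (Survives x y p)

/-- The consistent children of `p` that satisfy `A`. -/
def liveSuccs (A : ℕ × ℕ → Bool) (x y : ℕ → Fin 3) (p : ℕ × ℕ) : List (ℕ × ℕ) :=
  (succs x y p).filter A

/-- The digit that codes a list of children. -/
def branching (l : List (ℕ × ℕ)) : Fin 3 :=
  if 1 < l.length then 2 else if l.headI.1 % 2 = 1 then 0 else 1

/-- One step of the breadth-first generation of the tree of nodes satisfying `A`. -/
def advance (A : ℕ × ℕ → Bool) (x y : ℕ → Fin 3) (Q : List (ℕ × ℕ)) : List (ℕ × ℕ) :=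
  Q.tail ++ liveSuccs A x y Q.headI

/-- The code of the forest of nodes satisfying `A`, generated breadth-first from the queue `Q`. -/
def treeCode (A : ℕ × ℕ → Bool) (x y : ℕ → Fin 3) (Q : List (ℕ × ℕ)) (n : ℕ) : Fin 3 :=
  branching (liveSuccs A x y ((advance A x y)^[n] Q).headI)

variable {x y : ℕ → Fin 3}

@[simp] lemma immortal_eq_true {p : ℕ × ℕ} : immortal x y p = true ↔ Survives x y p := by
  simp [immortal]

lemma exists_of_mem_childAt {b : ℕ} {p q : ℕ × ℕ} (h : q ∈ childAt x y b p) :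
    q.1 = 2 * p.1 + 1 + b ∧ ∃ e : Fin 2, x (2 * p.1 + b) = (if e = 0 then 2 else y p.2) ∧
      q = (2 * p.1 + 1 + b, p.2 + e) := by
  unfold childAt at h
  split_ifs at h with h1 h2
  · rw [List.mem_singleton] at h; subst h; exact ⟨rfl, 0, by simp [h1], by simp⟩
  · rw [List.mem_singleton] at h; subst h; exact ⟨rfl, 1, by simp [h2], by simp⟩
  · simp at h

lemma childAt_eq_nil_or_singleton (b : ℕ) (p : ℕ × ℕ) :
    childAt x y b p = [] ∨ ∃ q, childAt x y b p = [q] := by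
  unfold childAt
  split_ifs <;> simp

lemma mem_succs {p q : ℕ × ℕ} :
    q ∈ succs x y p ↔ q ∈ childAt x y 0 p ∨ q ∈ childAt x y 1 p := by
  simp [succs]

lemma descend_eq_flatMap (n : ℕ) (l : List (ℕ × ℕ)) :
    descend x y n l = l.flatMap fun p => descend x y n [p] := by
  induction n generalizing l with
  | zero => simp [descend]
  | succ n ih =>
    have h : ∀ l, descend x y (n + 1) l = descend x y n (l.flatMap (succs x y)) := fun l => rfl
    rw [h, ih, List.flatMap_assoc]
    congr 1
    funext p
    rw [h, ih (List.flatMap _ [p])]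
    simp

lemma descend_eq_nil_iff {n : ℕ} {l : List (ℕ × ℕ)} :
    descend x y n l = [] ↔ ∀ p ∈ l, survives x y n p = false := by
  rw [descend_eq_flatMap]
  simp [survives]

@[simp] lemma survives_zero (p : ℕ × ℕ) : survives x y 0 p = true := by
  simp [survives, descend]

lemma survives_succ {n : ℕ} {p : ℕ × ℕ} :
    survives x y (n + 1) p = true ↔ ∃ q ∈ succs x y p, survives x y n q = true := by
  have h : descend x y (n + 1) [p] = descend x y n (succs x y p) := by
    simp [descend, Function.iterate_succ_apply]
  rw [survives, h]
  have := descend_eq_nil_iff (x := x) (y := y) (n := n) (l := succs x y p)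
  simp only [Bool.not_eq_true', List.isEmpty_eq_false_iff, ne_eq, this]
  push Not
  simp

lemma survives_of_succ {n : ℕ} {p : ℕ × ℕ} (h : survives x y (n + 1) p = true) :
    survives x y n p = true := by
  induction n generalizing p with
  | zero => simp
  | succ n ih =>
    obtain ⟨q, hq, h⟩ := survives_succ.1 h
    exact survives_succ.2 ⟨q, hq, ih h⟩

lemma survives_of_le {m n : ℕ} (hmn : m ≤ n) {p : ℕ × ℕ} (h : survives x y n p = true) :
    survives x y m p = true := by
  induction hmn with
  | refl => exact h
  | step _ ih => exact ih (survives_of_succ h)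

lemma Survives.of_succ {p q : ℕ × ℕ} (hq : q ∈ succs x y p) (h : Survives x y q) :
    Survives x y p := fun n => survives_of_succ (survives_succ.2 ⟨q, hq, h n⟩)

/-- Survival for `m` levels is decreasing in `m` with limit `Survives`. Every finite set of nodes is
therefore judged correctly by some finite lookahead. -/
lemma eventually_survives_eq_immortal (p : ℕ × ℕ) :
    ∀ᶠ m in Filter.atTop, survives x y m p = immortal x y p := by
  by_cases h : Survives x y p
  · exact Filter.Eventually.of_forall fun m => by rw [h m, immortal_eq_true.2 h]
  · obtain ⟨n, hn⟩ := not_forall.1 h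
    filter_upwards [Filter.eventually_ge_atTop n] with m hm
    rw [← immortal_eq_true, Bool.not_eq_true] at h
    rw [h, ← Bool.not_eq_true]
    exact fun h' => hn (survives_of_le hm h')

lemma eventually_filter_eq (l : List (ℕ × ℕ)) :
    ∀ᶠ m in Filter.atTop, l.filter (survives x y m) = l.filter (immortal x y) := by
  have : ∀ᶠ m in Filter.atTop, ∀ p ∈ l, survives x y m p = immortal x y p := by
    have := (List.finite_toSet l).eventually_all (l := Filter.atTop)
      (p := fun p m => survives x y m p = immortal x y p)
    exact this.2 fun p _ => eventually_survives_eq_immortal p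
  filter_upwards [this] with m hm
  exact List.filter_congr hm

/-- König's lemma: `p` has finitely many children, so one lookahead `m` is correct for all of them,
and survival of `p` for `m + 1` levels then yields an immortal child. -/
lemma Survives.exists_succ {p : ℕ × ℕ} (h : Survives x y p) :
    ∃ q ∈ succs x y p, Survives x y q := by
  obtain ⟨m, hm⟩ := (eventually_filter_eq (x := x) (y := y) (succs x y p)).exists
  obtain ⟨q, hq, h⟩ := survives_succ.1 (h (m + 1))
  have : q ∈ (succs x y p).filter (survives x y m) := List.mem_filter.2 ⟨hq, h⟩
  rw [hm, List.mem_filter, immortal_eq_true] at this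
  exact ⟨q, this⟩

lemma mem_liveSuccs_immortal {p q : ℕ × ℕ} :
    q ∈ liveSuccs (immortal x y) x y p ↔ q ∈ succs x y p ∧ Survives x y q := by
  simp [liveSuccs]

lemma Survives.liveSuccs_ne_nil {p : ℕ × ℕ} (h : Survives x y p) :
    liveSuccs (immortal x y) x y p ≠ [] := by
  obtain ⟨q, hq⟩ := h.exists_succ
  exact List.ne_nil_of_mem (mem_liveSuccs_immortal.2 hq)

lemma treeCode_zero (A : ℕ × ℕ → Bool) (Q : List (ℕ × ℕ)) :
    treeCode A x y Q 0 = branching (liveSuccs A x y Q.headI) := rfl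

lemma treeCode_succ (A : ℕ × ℕ → Bool) (Q : List (ℕ × ℕ)) (n : ℕ) :
    treeCode A x y Q (n + 1) = treeCode A x y (advance A x y Q) n := rfl

lemma restr_succ_eq_cons {n : ℕ} (u : InfSeq n) (k : ℕ) :
    restr u (k + 1) = u 0 :: restr (fun j => u (j + 1)) k := by
  simp [restr, List.range_succ_eq_map, Function.comp_def]

lemma restr_succ {n : ℕ} (u : InfSeq n) (k : ℕ) : restr u (k + 1) = restr u k ++ [u k] := by
  simp [restr, List.range_succ]

@[simp] lemma length_restr {n : ℕ} (u : InfSeq n) (k : ℕ) : (restr u k).length = k := by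
  simp [restr]

lemma advance_cons (A : ℕ × ℕ → Bool) (p : ℕ × ℕ) (Q : List (ℕ × ℕ)) :
    advance A x y (p :: Q) = Q ++ liveSuccs A x y p := rfl

/-- If all members of the queue survive, this remains so, and the queue does not become empty. -/
lemma advance_immortal {Q : List (ℕ × ℕ)} (hQ : Q ≠ []) (h : ∀ p ∈ Q, Survives x y p) :
    advance (immortal x y) x y Q ≠ [] ∧ ∀ p ∈ advance (immortal x y) x y Q, Survives x y p := by
  cases Q with
  | nil => exact absurd rfl hQ
  | cons p Q =>
    rw [advance_cons]
    refine ⟨by simp [(h p (by simp)).liveSuccs_ne_nil], fun q hq => ?_⟩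
    rcases List.mem_append.1 hq with hq | hq
    · exact h q (by simp [hq])
    · exact (mem_liveSuccs_immortal.1 hq).2

lemma iterate_advance_immortal {Q : List (ℕ × ℕ)} (hQ : Q ≠ []) (h : ∀ p ∈ Q, Survives x y p)
    (n : ℕ) : (advance (immortal x y) x y)^[n] Q ≠ [] ∧
      ∀ p ∈ (advance (immortal x y) x y)^[n] Q, Survives x y p := by
  induction n with
  | zero => exact ⟨hQ, h⟩
  | succ n ih =>
    rw [Function.iterate_succ_apply']
    exact advance_immortal ih.1 ih.2

end Trees

/-! ### Independence over disjoint coordinates and survival probabilities. -/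

section Measure

/-- The σ-algebra on `3^ω` generated by the coordinates in `S`. -/
@[reducible]
def coordsAlgebra (S : Set ℕ) : MeasurableSpace (InfSeq 3) :=
  ⨆ i ∈ S, MeasurableSpace.comap (fun x : InfSeq 3 => x i) inferInstance

lemma coordsAlgebra_mono {S T : Set ℕ} (h : S ⊆ T) : coordsAlgebra S ≤ coordsAlgebra T :=
  biSup_mono h

lemma measurableSet_mono {S T : Set ℕ} (h : S ⊆ T) {A : Set (InfSeq 3)}
    (hA : MeasurableSet[coordsAlgebra S] A) : MeasurableSet[coordsAlgebra T] A :=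
  coordsAlgebra_mono h A hA

lemma measurableSet_of_coords {S : Set ℕ} {A : Set (InfSeq 3)}
    (hA : MeasurableSet[coordsAlgebra S] A) : MeasurableSet A := by
  have : coordsAlgebra S ≤ (inferInstance : MeasurableSpace (InfSeq 3)) :=
    iSup₂_le fun i _ => (measurable_pi_apply i).comap_le
  exact this A hA

lemma measurableSet_coord (i : ℕ) (a : Fin 3) :
    MeasurableSet[coordsAlgebra {i}] {x : InfSeq 3 | x i = a} := by
  have : MeasurableSpace.comap (fun x : InfSeq 3 => x i) inferInstance ≤ coordsAlgebra {i} :=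
    le_iSup₂_of_le i rfl le_rfl
  exact this _ ⟨{a}, measurableSet_singleton a, rfl⟩

instance (n : ℕ) [NeZero n] : IsProbabilityMeasure (lebesgue n) := by
  unfold lebesgue; infer_instance

/-- Every independence argument below goes through this product rule: events are tracked with a set
of coordinates on which they depend. -/
lemma lebesgue_inter {S T : Set ℕ} (h : Disjoint S T) {A B : Set (InfSeq 3)}
    (hA : MeasurableSet[coordsAlgebra S] A) (hB : MeasurableSet[coordsAlgebra T] B) :
    (lebesgue 3).real (A ∩ B) = (lebesgue 3).real A * (lebesgue 3).real B := by
  have h1 : ProbabilityTheory.iIndepFun (fun (i : ℕ) (x : InfSeq 3) => x i) (lebesgue 3) :=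
    ProbabilityTheory.iIndepFun_infinitePi (X := fun _ a => a) (fun _ => measurable_id)
  have h2 := ProbabilityTheory.indep_iSup_of_disjoint
    (fun i => (measurable_pi_apply i).comap_le) h1.iIndep h
  have h3 := (ProbabilityTheory.Indep_iff _ _ _).1 h2 A B hA hB
  simp [measureReal_def, h3]

lemma lebesgue_pi (n : ℕ) [NeZero n] (s : Finset ℕ) (f : ℕ → Fin n) :
    lebesgue n {x | ∀ i ∈ s, x i = f i} = (n : ℝ≥0∞)⁻¹ ^ s.card := by
  have : {x : InfSeq n | ∀ i ∈ s, x i = f i} = Set.pi s fun i => {f i} := by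
    ext x; simp [Set.mem_pi]
  rw [this, lebesgue, Measure.infinitePi_pi _ fun i _ => measurableSet_singleton _]
  simp [PMF.toMeasure_apply_singleton _ _ (measurableSet_singleton _)]

lemma lebesgue_coord (i : ℕ) (a : Fin 3) : (lebesgue 3).real {x | x i = a} = 1 / 3 := by
  have := lebesgue_pi 3 {i} fun _ => a
  simp only [Finset.mem_singleton, forall_eq, Finset.card_singleton, pow_one] at this
  simp [measureReal_def, this]

lemma cylinder_eq {n : ℕ} [NeZero n] (ρ : List (Fin n)) : {z : InfSeq n | restr z ρ.length = ρ} =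
    {z | ∀ i ∈ Finset.range ρ.length, z i = ρ.getD i 0} := by
  ext z
  simp only [Set.mem_ofPred_eq, Finset.mem_range]
  constructor
  · intro h i hi
    rw [← h]
    simp [restr, hi]
  · intro h
    refine List.ext_getElem (by simp) fun i h1 h2 => ?_
    have := h i h2
    simp [restr, this, h2]

lemma measurableSet_cylinder {n : ℕ} [NeZero n] (ρ : List (Fin n)) :
    MeasurableSet {z : InfSeq n | restr z ρ.length = ρ} := by
  rw [cylinder_eq]
  have : {z : InfSeq n | ∀ i ∈ Finset.range ρ.length, z i = ρ.getD i 0} =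
      Set.pi (Finset.range ρ.length) fun i => {ρ.getD i 0} := by
    ext z; simp [Set.mem_pi]
  rw [this]
  exact MeasurableSet.pi (Finset.countable_toSet _) fun i _ => measurableSet_singleton _

lemma lebesgue_cylinder (n : ℕ) [NeZero n] (ρ : List (Fin n)) :
    lebesgue n {z | restr z ρ.length = ρ} = (n : ℝ≥0∞)⁻¹ ^ ρ.length := by
  rw [cylinder_eq, lebesgue_pi, Finset.card_range]

/-- The positions of the labels of the proper descendants of the `i`-th string. -/
def above (i : ℕ) : Set ℕ := {m | ∃ n, (m / 2 + 1) / 2 ^ n = i + 1}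

/-- Coordinate `m` labels the string at position `m + 1`, whose parent is at position `m / 2`. With
positions shifted by one, halving leads from a node to its parent, so `m ∈ above i` says that this
parent is `i` or a descendant of `i`. -/
lemma mem_above_self (i : ℕ) {b : ℕ} (hb : b < 2) : 2 * i + b ∈ above i :=
  ⟨0, by simp; omega⟩

lemma above_child_subset (i : ℕ) {b : ℕ} (hb : b < 2) : above (2 * i + 1 + b) ⊆ above i := by
  rintro m ⟨n, hn⟩
  refine ⟨n + 1, ?_⟩
  rw [pow_succ, ← Nat.div_div_eq_div_mul, hn]
  omega

lemma le_of_mem_above {i m : ℕ} (h : m ∈ above i) : 2 * i ≤ m := by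
  obtain ⟨n, hn⟩ := h
  have := Nat.div_le_self (m / 2 + 1) (2 ^ n)
  omega

lemma notMem_above_child (i : ℕ) {b : ℕ} (hb : b < 2) (b' : ℕ) :
    2 * i + b ∉ above (2 * i + 1 + b') := fun h => by
  have := le_of_mem_above h
  omega

/-- If both siblings are reached after the same number of halvings, they are equal. Otherwise one is
reached from the other by at least one further halving, which leads to a position at most `i`. -/
lemma disjoint_above_children (i : ℕ) : Disjoint (above (2 * i + 1 + 0)) (above (2 * i + 1 + 1)) := by
  rw [Set.disjoint_left]
  rintro m ⟨n, hn⟩ ⟨k, hk⟩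
  rcases lt_trichotomy n k with h | h | h
  · obtain ⟨d, rfl⟩ := Nat.exists_eq_add_of_lt h
    rw [add_assoc, pow_add, ← Nat.div_div_eq_div_mul, hn, pow_succ', ← Nat.div_div_eq_div_mul] at hk
    have := Nat.div_le_self ((2 * i + 1 + 0 + 1) / 2) (2 ^ d)
    omega
  · subst h; omega
  · obtain ⟨d, rfl⟩ := Nat.exists_eq_add_of_lt h
    rw [add_assoc, pow_add, ← Nat.div_div_eq_div_mul, hk, pow_succ', ← Nat.div_div_eq_div_mul] at hn
    have := Nat.div_le_self ((2 * i + 1 + 1 + 1) / 2) (2 ^ d)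
    omega

/-- The coordinates that the subtree of the child in direction `b`, with its root, depends on. -/
def branchCoords (i b : ℕ) : Set ℕ := insert (2 * i + b) (above (2 * i + 1 + b))

lemma branchCoords_subset (i : ℕ) {b : ℕ} (hb : b < 2) : branchCoords i b ⊆ above i :=
  Set.insert_subset (mem_above_self i hb) (above_child_subset i hb)

lemma disjoint_branchCoords (i : ℕ) : Disjoint (branchCoords i 0) (branchCoords i 1) := by
  unfold branchCoords
  rw [Set.disjoint_insert_left, Set.disjoint_insert_right]
  refine ⟨?_, notMem_above_child i (by norm_num) 0, disjoint_above_children i⟩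
  rw [Set.mem_insert_iff, not_or]
  exact ⟨by omega, notMem_above_child i (by norm_num) 1⟩

lemma disjoint_coord_above (i : ℕ) {b : ℕ} (hb : b < 2) :
    Disjoint ({2 * i + b} : Set ℕ) (above (2 * i + 1 + b)) :=
  Set.disjoint_singleton_left.2 (notMem_above_child i hb b)

variable {y : ℕ → Fin 3}

/-- The event that the child of `p` in direction `b` is consistent and has property `B`. -/
def childEvent (y : ℕ → Fin 3) (B : ℕ × ℕ → Set (InfSeq 3)) (b : ℕ) (p : ℕ × ℕ) :
    Set (InfSeq 3) := {x | ∃ q ∈ childAt x y b p, x ∈ B q}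

lemma childEvent_eq (B : ℕ × ℕ → Set (InfSeq 3)) (b : ℕ) (p : ℕ × ℕ) (h : y p.2 ≠ 2) :
    childEvent y B b p = ({x | x (2 * p.1 + b) = 2} ∩ B (2 * p.1 + 1 + b, p.2)) ∪
      ({x | x (2 * p.1 + b) = y p.2} ∩ B (2 * p.1 + 1 + b, p.2 + 1)) := by
  ext x
  simp only [childEvent, childAt, Set.mem_ofPred_eq, Set.mem_union, Set.mem_inter_iff]
  split_ifs with h1 h2
  · simp [h1, h.symm]
  · simp [h2, h]
  · simp [h1, h2]

/-- The value `2` is admitted for `y` because the constant sequence `2` describes the nodes reached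
over labels `2` only, which matter for the totality of the function. -/
lemma childEvent_eq_of_eq_two (B : ℕ × ℕ → Set (InfSeq 3)) (b : ℕ) (p : ℕ × ℕ) (h : y p.2 = 2) :
    childEvent y B b p = {x | x (2 * p.1 + b) = 2} ∩ B (2 * p.1 + 1 + b, p.2) := by
  ext x
  simp only [childEvent, childAt, Set.mem_ofPred_eq, Set.mem_inter_iff]
  split_ifs with h1 h2
  · simp [h1]
  · exact absurd (h2.trans h) h1
  · simp [h1]

lemma measurableSet_childEvent {B : ℕ × ℕ → Set (InfSeq 3)}
    (hB : ∀ q, MeasurableSet[coordsAlgebra (above q.1)] (B q)) (b : ℕ) (p : ℕ × ℕ) :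
    MeasurableSet[coordsAlgebra (branchCoords p.1 b)] (childEvent y B b p) := by
  have h1 : ∀ a c, MeasurableSet[coordsAlgebra (branchCoords p.1 b)]
      ({x | x (2 * p.1 + b) = a} ∩ B (2 * p.1 + 1 + b, c)) := fun a c =>
    (measurableSet_mono (by simp [branchCoords]) (measurableSet_coord _ _)).inter
      (measurableSet_mono (Set.subset_insert _ _) (hB (2 * p.1 + 1 + b, c)))
  by_cases h : y p.2 = 2
  · rw [childEvent_eq_of_eq_two _ _ _ h]
    exact h1 _ _
  · rw [childEvent_eq _ _ _ h]
    exact (h1 _ _).union (h1 _ _)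

lemma lebesgue_coord_inter {B : Set (InfSeq 3)} {i b : ℕ} (hb : b < 2)
    (hB : MeasurableSet[coordsAlgebra (above (2 * i + 1 + b))] B) (a : Fin 3) :
    (lebesgue 3).real ({x | x (2 * i + b) = a} ∩ B) = 1 / 3 * (lebesgue 3).real B := by
  rw [lebesgue_inter (disjoint_coord_above i hb) (measurableSet_coord _ _) hB, lebesgue_coord]

lemma lebesgue_childEvent {B : ℕ × ℕ → Set (InfSeq 3)}
    (hB : ∀ q, MeasurableSet[coordsAlgebra (above q.1)] (B q)) {s : ℝ}
    (hs : ∀ q, (lebesgue 3).real (B q) = s) {b : ℕ} (hb : b < 2) {p : ℕ × ℕ} (h : y p.2 ≠ 2) :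
    (lebesgue 3).real (childEvent y B b p) = 2 / 3 * s := by
  rw [childEvent_eq _ _ _ h, measureReal_union _ _]
  · rw [lebesgue_coord_inter hb (hB (_, _)), lebesgue_coord_inter hb (hB (_, _)), hs, hs]; ring
  · rw [Set.disjoint_left]
    rintro x ⟨h1, -⟩ ⟨h2, -⟩
    exact h (h2.symm.trans h1)
  · exact (measurableSet_of_coords (measurableSet_coord _ _)).inter
      (measurableSet_of_coords (hB (_, _)))

lemma setOf_survives_succ (n : ℕ) (p : ℕ × ℕ) :
    {x : InfSeq 3 | survives x y (n + 1) p = true} =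
      childEvent y (fun q => {x | survives x y n q = true}) 0 p ∪
      childEvent y (fun q => {x | survives x y n q = true}) 1 p := by
  ext x
  simp only [Set.mem_ofPred_eq, survives_succ, mem_succs, childEvent, Set.mem_union, or_and_right,
    exists_or]

lemma measurableSet_survives (n : ℕ) (p : ℕ × ℕ) :
    MeasurableSet[coordsAlgebra (above p.1)] {x : InfSeq 3 | survives x y n p = true} := by
  induction n generalizing p with
  | zero => simp
  | succ n ih =>
    rw [setOf_survives_succ]
    exact (measurableSet_mono (branchCoords_subset _ (by norm_num))
      (measurableSet_childEvent ih 0 p)).union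
        (measurableSet_mono (branchCoords_subset _ (by norm_num))
          (measurableSet_childEvent ih 1 p))

lemma setOf_survives (p : ℕ × ℕ) :
    {x : InfSeq 3 | Survives x y p} = ⋂ n, {x | survives x y n p = true} := by
  ext x; simp [Survives]

lemma measurableSet_survives_forever (p : ℕ × ℕ) :
    MeasurableSet[coordsAlgebra (above p.1)] {x : InfSeq 3 | Survives x y p} := by
  rw [setOf_survives]
  exact MeasurableSet.iInter fun n => measurableSet_survives n p

/-- The probability that a node has a consistent descendant `n` levels up. -/
noncomputable def survivalProb : ℕ → ℝ
  | 0 => 1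
  | n + 1 => 1 - (1 - 2 / 3 * survivalProb n) * (1 - 2 / 3 * survivalProb n)

/-- The recursion has the fixed point 3/4, and the deviation `d` from it becomes `d * (2/3 - 4/9 *
d)`, so it stays nonnegative and shrinks at least by the factor 2/3 from its initial value 1/4. -/
lemma survivalProb_bounds (n : ℕ) :
    0 ≤ survivalProb n - 3 / 4 ∧ survivalProb n - 3 / 4 ≤ 1 / 4 * (2 / 3) ^ n := by
  induction n with
  | zero => norm_num [survivalProb]
  | succ n ih =>
    have h1 : (2 / 3 : ℝ) ^ n ≤ 1 := pow_le_one₀ (by norm_num) (by norm_num)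
    have h2 : survivalProb (n + 1) - 3 / 4 =
        (survivalProb n - 3 / 4) * (2 / 3 - 4 / 9 * (survivalProb n - 3 / 4)) := by
      rw [survivalProb]; ring
    rw [h2, pow_succ]
    constructor
    · exact mul_nonneg ih.1 (by linarith [ih.2])
    · nlinarith [ih.1, ih.2]

/-- Failure means failure in both directions, and these two events are independent; this gives the
recursion of `survivalProb`. -/
lemma lebesgue_survives (hy : ∀ c, y c ≠ 2) (n : ℕ) (p : ℕ × ℕ) :
    (lebesgue 3).real {x | survives x y n p = true} = survivalProb n := by
  induction n generalizing p with
  | zero => simp [survivalProb]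
  | succ n ih =>
    have hm := fun b => measurableSet_childEvent (y := y)
      (fun q => measurableSet_survives (y := y) n q) b p
    have hc : ∀ b < 2, (lebesgue 3).real
        (childEvent y (fun q => {x | survives x y n q = true}) b p)ᶜ = 1 - 2 / 3 * survivalProb n := by
      intro b hb
      rw [probReal_compl_eq_one_sub (measurableSet_of_coords (hm b)),
        lebesgue_childEvent (fun q => measurableSet_survives n q) ih hb (hy _)]
    rw [setOf_survives_succ, ← compl_compl (_ ∪ _), Set.compl_union, probReal_compl_eq_one_sub,
      lebesgue_inter (disjoint_branchCoords p.1) (hm 0).compl (hm 1).compl, hc 0 (by norm_num),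
      hc 1 (by norm_num), survivalProb]
    exact (measurableSet_of_coords (hm 0).compl).inter (measurableSet_of_coords (hm 1).compl)

lemma lebesgue_survives_forever (hy : ∀ c, y c ≠ 2) (p : ℕ × ℕ) :
    (lebesgue 3).real {x | Survives x y p} = 3 / 4 := by
  have h1 : Filter.Tendsto (fun n => (lebesgue 3) {x : InfSeq 3 | survives x y n p = true})
      Filter.atTop (nhds ((lebesgue 3) {x | Survives x y p})) := by
    rw [setOf_survives]
    refine tendsto_measure_iInter_atTop
      (fun n => (measurableSet_of_coords (measurableSet_survives n p)).nullMeasurableSet) ?_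
      ⟨0, measure_ne_top _ _⟩
    exact antitone_nat_of_succ_le fun n x hx => survives_of_succ hx
  have h2 := (ENNReal.tendsto_toReal (measure_ne_top _ _)).comp h1
  have h3 : Filter.Tendsto survivalProb Filter.atTop (nhds (3 / 4)) := by
    have h4 : Filter.Tendsto (fun n => 3 / 4 + 1 / 4 * (2 / 3 : ℝ) ^ n) Filter.atTop
        (nhds (3 / 4 + 1 / 4 * 0)) :=
      ((tendsto_pow_atTop_nhds_zero_of_lt_one (by norm_num) (by norm_num)).const_mul _).const_add _
    rw [mul_zero, add_zero] at h4
    exact tendsto_of_tendsto_of_tendsto_of_le_of_le tendsto_const_nhds h4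
      (fun n => by linarith [(survivalProb_bounds n).1])
      (fun n => by linarith [(survivalProb_bounds n).2])
  refine tendsto_nhds_unique h2 (h3.congr fun n => ?_)
  exact (lebesgue_survives hy n p).symm

/-- A subtree that survives for `n` levels is likely to survive forever. -/
lemma lebesgue_survives_not_forever (hy : ∀ c, y c ≠ 2) (n : ℕ) (p : ℕ × ℕ) :
    (lebesgue 3).real {x | survives x y n p = true ∧ ¬ Survives x y p} ≤ 1 / 4 * (2 / 3) ^ n := by
  have : {x : InfSeq 3 | survives x y n p = true ∧ ¬ Survives x y p} =
      {x | survives x y n p = true} \ {x | Survives x y p} := rfl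
  have hsub : {x : InfSeq 3 | Survives x y p} ⊆ {x | survives x y n p = true} :=
    fun x (hx : Survives x y p) => hx n
  rw [this, measureReal_sdiff hsub
    (measurableSet_of_coords (measurableSet_survives_forever p)),
    lebesgue_survives hy, lebesgue_survives_forever hy]
  exact (survivalProb_bounds n).2

/-- Here a child is admitted with probability 1/3 only, so a union bound over the two children gains
a factor 2/3 per level. -/
lemma lebesgue_survives_two (n : ℕ) (p : ℕ × ℕ) :
    (lebesgue 3).real {x | survives x (fun _ => 2) n p = true} ≤ (2 / 3) ^ n := by
  induction n generalizing p with
  | zero => simp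
  | succ n ih =>
    rw [setOf_survives_succ]
    refine (measureReal_union_le _ _).trans ?_
    have : ∀ b < 2, (lebesgue 3).real (childEvent (fun _ => 2)
        (fun q => {x | survives x (fun _ => 2) n q = true}) b p) ≤ 1 / 3 * (2 / 3) ^ n := by
      intro b hb
      rw [childEvent_eq_of_eq_two _ _ _ rfl, lebesgue_coord_inter hb
        (measurableSet_survives (y := fun _ => 2) n (2 * p.1 + 1 + b, p.2))]
      exact mul_le_mul_of_nonneg_left (ih _) (by norm_num)
    calc _ ≤ _ := add_le_add (this 0 (by norm_num)) (this 1 (by norm_num))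
      _ = _ := by ring

end Measure

/-! ### The law of the code of the surviving tree. -/

section CodeLaw

variable {y : ℕ → Fin 3}

/-- The node reached from `p` in direction `b` over a label `2` (`e = 0`) or over the next digit
of `y` (`e = 1`). -/
def childNode (p : ℕ × ℕ) (b : ℕ) (e : Fin 2) : ℕ × ℕ := (2 * p.1 + 1 + b, p.2 + e)

/-- The label over which `childNode p b e` is reached from `p`. -/
def stepLabel (y : ℕ → Fin 3) (p : ℕ × ℕ) (e : Fin 2) : Fin 3 := if e = 0 then 2 else y p.2

/-- The coordinates that the subtrees above the nodes in `Q` depend on. -/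
def aboveAll (Q : List (ℕ × ℕ)) : Set ℕ := ⋃ p ∈ Q, above p.1

lemma aboveAll_append (Q R : List (ℕ × ℕ)) : aboveAll (Q ++ R) = aboveAll Q ∪ aboveAll R := by
  ext i; simp [aboveAll, or_and_right, exists_or]

lemma aboveAll_cons (p : ℕ × ℕ) (Q : List (ℕ × ℕ)) :
    aboveAll (p :: Q) = above p.1 ∪ aboveAll Q := by
  ext i; simp [aboveAll]

lemma aboveAll_nil : aboveAll [] = ∅ := by simp [aboveAll]

/-- The queue consists of pairwise incomparable nodes. -/
def Incomparable (Q : List (ℕ × ℕ)) : Prop :=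
  Q.Pairwise fun p q => Disjoint (above p.1) (above q.1)

lemma disjoint_aboveAll {p : ℕ × ℕ} {Q : List (ℕ × ℕ)} (h : Incomparable (p :: Q)) :
    Disjoint (above p.1) (aboveAll Q) := by
  simp only [aboveAll, Set.disjoint_iUnion_right]
  exact (List.pairwise_cons.1 h).1

lemma Incomparable.append_childNode {p : ℕ × ℕ} {Q : List (ℕ × ℕ)} (h : Incomparable (p :: Q))
    {b : ℕ} (hb : b < 2) (e : Fin 2) : Incomparable (Q ++ [childNode p b e]) := by
  refine List.pairwise_append.2 ⟨(List.pairwise_cons.1 h).2, by simp, ?_⟩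
  intro q hq r hr
  rw [List.mem_singleton.1 hr]
  exact ((List.pairwise_cons.1 h).1 q hq).symm.mono_right (above_child_subset _ hb)

lemma Incomparable.append_childNodes {p : ℕ × ℕ} {Q : List (ℕ × ℕ)} (h : Incomparable (p :: Q))
    (e e' : Fin 2) : Incomparable (Q ++ [childNode p 0 e, childNode p 1 e']) := by
  refine List.pairwise_append.2 ⟨(List.pairwise_cons.1 h).2, ?_, ?_⟩
  · simpa [childNode] using disjoint_above_children p.1
  · intro q hq r hr
    have hd := ((List.pairwise_cons.1 h).1 q hq).symm
    simp only [List.mem_cons, List.not_mem_nil, or_false] at hr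
    rcases hr with rfl | rfl
    · exact hd.mono_right (above_child_subset _ (by norm_num))
    · exact hd.mono_right (above_child_subset _ (by norm_num))

/-- The event that the child of `p` in direction `b` is not in the tree. -/
def deadEvent (y : ℕ → Fin 3) (b : ℕ) (p : ℕ × ℕ) : Set (InfSeq 3) :=
  (childEvent y (fun q => {x | Survives x y q}) b p)ᶜ

lemma measurableSet_deadEvent (b : ℕ) (p : ℕ × ℕ) :
    MeasurableSet[coordsAlgebra (branchCoords p.1 b)] (deadEvent y b p) :=
  (measurableSet_childEvent measurableSet_survives_forever b p).compl

/-- 1 - 2/3 · 3/4 = 1/2: whether a child belongs to the tree is a fair coin toss. This coincidence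
is what makes the code uniform. -/
lemma lebesgue_deadEvent (hy : ∀ c, y c ≠ 2) {b : ℕ} (hb : b < 2) (p : ℕ × ℕ) :
    (lebesgue 3).real (deadEvent y b p) = 1 / 2 := by
  rw [deadEvent, probReal_compl_eq_one_sub
    (measurableSet_of_coords (measurableSet_childEvent measurableSet_survives_forever b p)),
    lebesgue_childEvent measurableSet_survives_forever (lebesgue_survives_forever hy) hb (hy _)]
  norm_num

/-- The part of the surviving queue contributed by the two directions. -/
lemma liveSuccs_cases (x y : ℕ → Fin 3) (p : ℕ × ℕ) (b : ℕ) :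
    (x ∈ deadEvent y b p ∧ (childAt x y b p).filter (immortal x y) = []) ∨
    ∃ e, x (2 * p.1 + b) = stepLabel y p e ∧
      (childAt x y b p).filter (immortal x y) = [childNode p b e] := by
  rcases childAt_eq_nil_or_singleton (x := x) (y := y) b p with h | ⟨q, h⟩
  · left; simp [deadEvent, childEvent, h]
  · by_cases hq : Survives x y q
    · right
      obtain ⟨-, e, h1, h2⟩ := exists_of_mem_childAt (x := x) (y := y) (b := b) (p := p) (q := q)
        (by simp [h])
      refine ⟨e, h1, ?_⟩
      rw [h, List.filter_cons_of_pos (by simpa using hq), List.filter_nil, h2]; rfl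
    · left
      refine ⟨?_, by simp [h, hq]⟩
      rintro ⟨r, hr, hx⟩
      rw [h, List.mem_singleton] at hr
      exact hq (hr ▸ hx)

/-- The event that all nodes in `Q` survive and the code of the surviving forest above `Q`
starts with `ρ`. -/
def codeEvent (y : ℕ → Fin 3) (ρ : List (Fin 3)) (Q : List (ℕ × ℕ)) : Set (InfSeq 3) :=
  {x | (∀ p ∈ Q, Survives x y p) ∧ restr (treeCode (immortal x y) x y Q) ρ.length = ρ}

lemma codeEvent_cons_subset (a : Fin 3) (ρ : List (Fin 3)) (p : ℕ × ℕ) (Q : List (ℕ × ℕ)) :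
    codeEvent y (a :: ρ) (p :: Q) ⊆
      {x | branching (liveSuccs (immortal x y) x y p) = a ∧
        liveSuccs (immortal x y) x y p ≠ [] ∧
        x ∈ codeEvent y ρ (Q ++ liveSuccs (immortal x y) x y p)} := by
  rintro x ⟨h1, h2⟩
  rw [List.length_cons, restr_succ_eq_cons] at h2
  obtain ⟨h3, h4⟩ := List.cons.inj h2
  refine ⟨h3, (h1 p (by simp)).liveSuccs_ne_nil, ?_, h4⟩
  exact (advance_immortal (by simp) h1).2

/-- The factor `(3 / 4) ^ Q.length` is the probability that the whole queue survives, and each digit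
of `ρ` contributes 1/3. The induction on `ρ` treats the head of the queue: the first digit says
which of its children survive, and these move to the end of the queue. Incomparability keeps the
coordinates of different queue members disjoint. The measurable superset `B`, depending only on the
coordinates above `Q`, is carried along so that the product rule applies without measurability of
`codeEvent` itself. -/
lemma codeEvent_bound (hy : ∀ c, y c ≠ 2) (ρ : List (Fin 3)) (Q : List (ℕ × ℕ)) (hQ : Q ≠ [])
    (hI : Incomparable Q) :
    ∃ B, MeasurableSet[coordsAlgebra (aboveAll Q)] B ∧ codeEvent y ρ Q ⊆ B ∧
      (lebesgue 3).real B ≤ (3 / 4) ^ Q.length * (1 / 3) ^ ρ.length := by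
  induction ρ generalizing Q with
  | nil =>
    clear hQ
    induction Q with
    | nil => exact ⟨Set.univ, MeasurableSet.univ, Set.subset_univ _, by simp⟩
    | cons p Q ih =>
      obtain ⟨B, h1, h2, h3⟩ := ih (List.pairwise_cons.1 hI).2
      refine ⟨{x | Survives x y p} ∩ B, ?_, ?_, ?_⟩
      · rw [aboveAll_cons]
        exact (measurableSet_mono Set.subset_union_left (measurableSet_survives_forever p)).inter
          (measurableSet_mono Set.subset_union_right h1)
      · rintro x ⟨hx, -⟩
        exact ⟨hx p (by simp), h2 ⟨fun q hq => hx q (by simp [hq]), rfl⟩⟩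
      · rw [lebesgue_inter (disjoint_aboveAll hI) (measurableSet_survives_forever p) h1,
          lebesgue_survives_forever hy, List.length_cons, pow_succ', mul_assoc]
        exact mul_le_mul_of_nonneg_left h3 (by norm_num)
  | cons a ρ ih =>
    obtain ⟨p, Q, rfl⟩ := List.exists_cons_of_ne_nil hQ
    have hd := disjoint_aboveAll hI
    -- one child survives
    have single : ∀ b < 2, ∀ b' < 2, Disjoint (branchCoords p.1 b) (branchCoords p.1 b') →
        ∃ B, MeasurableSet[coordsAlgebra (aboveAll (p :: Q))] B ∧
          (∀ x ∈ deadEvent y b' p, ∀ e, x (2 * p.1 + b) = stepLabel y p e →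
            x ∈ codeEvent y ρ (Q ++ [childNode p b e]) → x ∈ B) ∧
          (lebesgue 3).real B ≤ (3 / 4) ^ (p :: Q).length * (1 / 3) ^ (a :: ρ).length := by
      intro b hb b' hb' hbb
      have := fun e => ih (Q ++ [childNode p b e]) (by simp) (hI.append_childNode hb e)
      choose B hB1 hB2 hB3 using this
      have hs : ∀ e, aboveAll (Q ++ [childNode p b e]) = aboveAll Q ∪ above (2 * p.1 + 1 + b) := by
        intro e; rw [aboveAll_append, aboveAll_cons, aboveAll_nil, Set.union_empty]; rfl
      have hm : ∀ e, MeasurableSet[coordsAlgebra (branchCoords p.1 b ∪ aboveAll Q)]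
          ({x | x (2 * p.1 + b) = stepLabel y p e} ∩ B e) := fun e =>
        (measurableSet_mono (by intro i hi; left; exact Or.inl hi) (measurableSet_coord _ _)).inter
          (measurableSet_mono (by
            rw [hs]; exact Set.union_subset Set.subset_union_right
              ((Set.subset_insert _ _).trans Set.subset_union_left)) (hB1 e))
      have hdd : Disjoint (branchCoords p.1 b') (branchCoords p.1 b ∪ aboveAll Q) :=
        Set.disjoint_union_right.2 ⟨hbb.symm, hd.mono_left (branchCoords_subset _ hb')⟩
      refine ⟨⋃ e, deadEvent y b' p ∩ ({x | x (2 * p.1 + b) = stepLabel y p e} ∩ B e),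
        ?_, ?_, ?_⟩
      · rw [aboveAll_cons]
        refine MeasurableSet.iUnion fun e => (measurableSet_mono ?_
          (measurableSet_deadEvent b' p)).inter (measurableSet_mono ?_ (hm e))
        · exact (branchCoords_subset _ hb').trans Set.subset_union_left
        · exact Set.union_subset_union_left _ (branchCoords_subset _ hb)
      · intro x hx e he hc
        exact Set.mem_iUnion.2 ⟨e, hx, he, hB2 e hc⟩
      · refine (measureReal_iUnion_fintype_le _).trans ?_
        -- The sibling is dead with probability 1/2 and the label is prescribed with probability
        -- 1/3; the queue keeps its length. The two values of `e` give 2 · 1/2 · 1/3 = 1/3.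
        have : ∀ e ∈ Finset.univ, (lebesgue 3).real (deadEvent y b' p ∩
            ({x | x (2 * p.1 + b) = stepLabel y p e} ∩ B e)) ≤
            1 / 2 * (1 / 3 * ((3 / 4) ^ (Q.length + 1) * (1 / 3) ^ ρ.length)) := by
          intro e _
          rw [lebesgue_inter hdd (measurableSet_deadEvent b' p) (hm e), lebesgue_deadEvent hy hb',
            lebesgue_inter _ (measurableSet_coord _ _) (hB1 e), lebesgue_coord]
          · have := hB3 e
            rw [List.length_append, List.length_singleton] at this
            gcongr
          · rw [hs]
            refine Set.disjoint_union_right.2 ⟨hd.mono_left ?_, disjoint_coord_above _ hb⟩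
            exact Set.singleton_subset_iff.2 (mem_above_self _ hb)
        refine (Finset.sum_le_sum this).trans (le_of_eq ?_)
        simp only [Finset.sum_const, Finset.card_univ, Fintype.card_fin, List.length_cons, nsmul_eq_mul,
          pow_succ]
        push_cast
        ring
    -- both children survive
    have double : ∃ B, MeasurableSet[coordsAlgebra (aboveAll (p :: Q))] B ∧
          (∀ x e e', x (2 * p.1 + 0) = stepLabel y p e → x (2 * p.1 + 1) = stepLabel y p e' →
            x ∈ codeEvent y ρ (Q ++ [childNode p 0 e, childNode p 1 e']) → x ∈ B) ∧
          (lebesgue 3).real B ≤ (3 / 4) ^ (p :: Q).length * (1 / 3) ^ (a :: ρ).length := by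
      have := fun e : Fin 2 × Fin 2 => ih (Q ++ [childNode p 0 e.1, childNode p 1 e.2]) (by simp)
        (hI.append_childNodes e.1 e.2)
      choose B hB1 hB2 hB3 using this
      have hs : ∀ e : Fin 2 × Fin 2, aboveAll (Q ++ [childNode p 0 e.1, childNode p 1 e.2]) =
          aboveAll Q ∪ (above (2 * p.1 + 1 + 0) ∪ above (2 * p.1 + 1 + 1)) := by
        intro e
        rw [aboveAll_append, aboveAll_cons, aboveAll_cons, aboveAll_nil, Set.union_empty]; rfl
      have hT : ∀ b < 2, Disjoint ({2 * p.1 + b} : Set ℕ)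
          (aboveAll Q ∪ (above (2 * p.1 + 1 + 0) ∪ above (2 * p.1 + 1 + 1))) := by
        intro b hb
        rw [Set.disjoint_singleton_left, Set.mem_union, Set.mem_union, not_or, not_or]
        exact ⟨Set.disjoint_left.1 hd (mem_above_self _ hb), notMem_above_child _ hb _,
          notMem_above_child _ hb _⟩
      have hm : ∀ e : Fin 2 × Fin 2, MeasurableSet[coordsAlgebra ({2 * p.1 + 1} ∪
          (aboveAll Q ∪ (above (2 * p.1 + 1 + 0) ∪ above (2 * p.1 + 1 + 1))))]
          ({x | x (2 * p.1 + 1) = stepLabel y p e.2} ∩ B e) := fun e =>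
        (measurableSet_mono Set.subset_union_left (measurableSet_coord _ _)).inter
          (measurableSet_mono (by rw [hs]; exact Set.subset_union_right) (hB1 e))
      refine ⟨⋃ e : Fin 2 × Fin 2, {x | x (2 * p.1 + 0) = stepLabel y p e.1} ∩
        ({x | x (2 * p.1 + 1) = stepLabel y p e.2} ∩ B e), ?_, ?_, ?_⟩
      · rw [aboveAll_cons]
        refine MeasurableSet.iUnion fun e => (measurableSet_mono ?_
          (measurableSet_coord _ _)).inter (measurableSet_mono ?_ (hm e))
        · exact (Set.singleton_subset_iff.2 (mem_above_self _ (by norm_num))).trans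
            Set.subset_union_left
        · refine Set.union_subset ((Set.singleton_subset_iff.2
            (mem_above_self _ (by norm_num))).trans Set.subset_union_left)
            (Set.union_subset Set.subset_union_right (Set.union_subset ?_ ?_))
          · exact (above_child_subset _ (by norm_num)).trans Set.subset_union_left
          · exact (above_child_subset _ (by norm_num)).trans Set.subset_union_left
      · intro x e e' he he' hc
        exact Set.mem_iUnion.2 ⟨(e, e'), he, he', hB2 (e, e') hc⟩
      · refine (measureReal_iUnion_fintype_le _).trans ?_
        -- Both labels are prescribed with probability 1/9, and the queue grows by one node, at the
        -- cost of a factor 3/4. The four pairs give 4 · 1/9 · 3/4 = 1/3.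
        have : ∀ e ∈ Finset.univ, (lebesgue 3).real ({x | x (2 * p.1 + 0) = stepLabel y p e.1} ∩
            ({x | x (2 * p.1 + 1) = stepLabel y p e.2} ∩ B e)) ≤
            1 / 3 * (1 / 3 * ((3 / 4) ^ (Q.length + 2) * (1 / 3) ^ ρ.length)) := by
          intro e _
          rw [lebesgue_inter _ (measurableSet_coord _ _) (hm e), lebesgue_coord,
            lebesgue_inter _ (measurableSet_coord _ _) (hB1 e), lebesgue_coord]
          · have := hB3 e
            rw [List.length_append, List.length_cons, List.length_singleton] at this
            gcongr
          · rw [hs]; exact hT 1 (by norm_num)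
          · exact Set.disjoint_union_right.2 ⟨by simp, hT 0 (by norm_num)⟩
        refine (Finset.sum_le_sum this).trans (le_of_eq ?_)
        simp only [Finset.sum_const, Finset.card_univ, Fintype.card_prod, Fintype.card_fin,
          List.length_cons, nsmul_eq_mul, pow_succ]
        push_cast
        ring
    have hlive : ∀ x, liveSuccs (immortal x y) x y p =
        (childAt x y 0 p).filter (immortal x y) ++ (childAt x y 1 p).filter (immortal x y) :=
      fun x => by simp [liveSuccs, succs]
    obtain ⟨B0, m0, s0, l0⟩ := single 0 (by norm_num) 1 (by norm_num) (disjoint_branchCoords p.1)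
    obtain ⟨B1, m1, s1, l1⟩ := single 1 (by norm_num) 0 (by norm_num)
      (disjoint_branchCoords p.1).symm
    obtain ⟨B2, m2, s2, l2⟩ := double
    have key : ∀ x ∈ codeEvent y (a :: ρ) (p :: Q),
        (a = 0 ∧ x ∈ B0) ∨ (a = 1 ∧ x ∈ B1) ∨ (a = 2 ∧ x ∈ B2) := by
      intro x hx
      obtain ⟨h1, h2, h3⟩ := codeEvent_cons_subset a ρ p Q hx
      rw [hlive] at h1 h2 h3
      rcases liveSuccs_cases x y p 0 with ⟨hd0, h0⟩ | ⟨e, he, h0⟩ <;>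
        rcases liveSuccs_cases x y p 1 with ⟨hd1, h4⟩ | ⟨e', he', h4⟩ <;>
        rw [h0, h4] at h1 h2 h3
      · exact absurd rfl h2
      · refine Or.inr (Or.inl ⟨?_, s1 x hd0 e' he' h3⟩)
        rw [← h1]
        simp [branching, childNode, show (2 * p.1 + 1 + 1) % 2 = 0 by omega]
      · refine Or.inl ⟨?_, s0 x hd1 e he h3⟩
        rw [← h1]
        simp [branching, childNode, show (2 * p.1 + 1) % 2 = 1 by omega]
      · refine Or.inr (Or.inr ⟨?_, s2 x e e' he he' h3⟩)
        rw [← h1]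
        simp [branching]
    have ha : a = 0 ∨ a = 1 ∨ a = 2 := by fin_cases a <;> simp
    rcases ha with rfl | rfl | rfl
    · exact ⟨B0, m0, fun x hx => by simpa using key x hx, l0⟩
    · exact ⟨B1, m1, fun x hx => by simpa using key x hx, l1⟩
    · exact ⟨B2, m2, fun x hx => by simpa using key x hx, l2⟩

/-- The factor 3/4 for the survival of `p` is simply dropped. -/
lemma lebesgue_codeEvent_le (hy : ∀ c, y c ≠ 2) (ρ : List (Fin 3)) (p : ℕ × ℕ) :
    lebesgue 3 (codeEvent y ρ [p]) ≤ lebesgue 3 {z | restr z ρ.length = ρ} := by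
  obtain ⟨B, -, h2, h3⟩ := codeEvent_bound hy ρ [p] (by simp) (List.pairwise_singleton _ _)
  refine (measure_mono h2).trans ?_
  rw [lebesgue_cylinder, ← ENNReal.ofReal_toReal (measure_ne_top (lebesgue 3) B)]
  refine ENNReal.ofReal_le_of_le_toReal (h3.trans ?_)
  simp only [List.length_singleton, pow_one, one_div, inv_pow, ENNReal.toReal_inv,
    ENNReal.toReal_pow, ENNReal.toReal_natCast]
  push_cast
  have : (0 : ℝ) ≤ (3 ^ ρ.length)⁻¹ := by positivity
  linarith

end CodeLaw

/-! ### Computability of the finite approximations, with finite strings as oracles. -/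

/-- A finite string as a sequence, continued by `0`s. -/
def oracle (τ : List (Fin 3)) (n : ℕ) : Fin 3 := τ.getD n 0

lemma oracle_restr (x : InfSeq 3) {L n : ℕ} (h : n < L) : oracle (restr x L) n = x n := by
  simp [oracle, restr, h]

section Computability

variable {y : ℕ → Fin 3} (hy : Primrec y)
include hy

lemma primrec_childAt (b : ℕ) :
    Primrec₂ fun (τ : List (Fin 3)) (p : ℕ × ℕ) => childAt (oracle τ) y b p := by
  have hi : Primrec fun a : List (Fin 3) × ℕ × ℕ => 2 * a.2.1 :=
    Primrec.nat_mul.comp (Primrec.const 2) (Primrec.fst.comp Primrec.snd)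
  have hx : Primrec fun a : List (Fin 3) × ℕ × ℕ => oracle a.1 (2 * a.2.1 + b) :=
    (Primrec.list_getD 0).comp Primrec.fst (Primrec.nat_add.comp hi (Primrec.const b))
  have hn : Primrec fun a : List (Fin 3) × ℕ × ℕ => 2 * a.2.1 + 1 + b :=
    Primrec.nat_add.comp (Primrec.succ.comp hi) (Primrec.const b)
  have hc : Primrec fun a : List (Fin 3) × ℕ × ℕ => a.2.2 := Primrec.snd.comp Primrec.snd
  exact Primrec.ite (Primrec.eq.comp hx (Primrec.const 2))
    (Primrec.list_cons.comp (Primrec.pair hn hc) (Primrec.const []))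
    (Primrec.ite (Primrec.eq.comp hx (hy.comp hc))
      (Primrec.list_cons.comp (Primrec.pair hn (Primrec.succ.comp hc)) (Primrec.const []))
      (Primrec.const []))

lemma primrec_succs : Primrec₂ fun (τ : List (Fin 3)) p => succs (oracle τ) y p :=
  Primrec.list_append.comp₂ (primrec_childAt hy 0) (primrec_childAt hy 1)

lemma primrec_descend :
    Primrec fun a : List (Fin 3) × ℕ × List (ℕ × ℕ) => descend (oracle a.1) y a.2.1 a.2.2 := by
  refine Primrec.nat_iterate (Primrec.fst.comp Primrec.snd) (Primrec.snd.comp Primrec.snd)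
    (h := fun a (l : List (ℕ × ℕ)) => l.flatMap (succs (oracle a.1) y)) ?_
  exact Primrec.list_flatMap Primrec.snd
    ((primrec_succs hy).comp (Primrec.fst.comp (Primrec.fst.comp Primrec.fst)) Primrec.snd)

lemma primrec_survives :
    Primrec fun a : (List (Fin 3) × ℕ) × (ℕ × ℕ) => survives (oracle a.1.1) y a.1.2 a.2 := by
  have h1 : Primrec fun a : (List (Fin 3) × ℕ) × (ℕ × ℕ) =>
      descend (oracle a.1.1) y a.1.2 [a.2] :=
    (primrec_descend hy).comp (Primrec.pair (Primrec.fst.comp Primrec.fst)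
      (Primrec.pair (Primrec.snd.comp Primrec.fst)
        (Primrec.list_cons.comp Primrec.snd (Primrec.const []))))
  have h2 : PrimrecPred fun a : (List (Fin 3) × ℕ) × (ℕ × ℕ) =>
      (descend (oracle a.1.1) y a.1.2 [a.2]).length = 0 :=
    Primrec.eq.comp (Primrec.list_length.comp h1) (Primrec.const 0)
  refine (Primrec.not.comp h2.decide).of_eq fun a => ?_
  rw [survives, Bool.eq_iff_iff]
  simp

lemma primrec_liveSuccs :
    Primrec₂ fun (a : List (Fin 3) × ℕ) p =>
      liveSuccs (survives (oracle a.1) y a.2) (oracle a.1) y p := by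
  -- The filter is written as a `flatMap` of lists with at most one member.
  have h : Primrec fun a : (List (Fin 3) × ℕ) × (ℕ × ℕ) =>
      (succs (oracle a.1.1) y a.2).flatMap
        fun q => cond (survives (oracle a.1.1) y a.1.2 q) [q] [] := by
    refine Primrec.list_flatMap
      ((primrec_succs hy).comp (Primrec.fst.comp Primrec.fst) Primrec.snd) ?_
    exact Primrec.cond ((primrec_survives hy).comp
      (Primrec.pair (Primrec.fst.comp Primrec.fst) Primrec.snd))
      (Primrec.list_cons.comp Primrec.snd (Primrec.const [])) (Primrec.const [])
  refine h.of_eq fun a => ?_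
  change _ = (succs (oracle a.1.1) y a.2).filter _
  induction succs (oracle a.1.1) y a.2 with
  | nil => rfl
  | cons q l ih =>
    rw [List.flatMap_cons, ih, List.filter_cons]
    cases survives (oracle a.1.1) y a.1.2 q <;> rfl

omit hy in
lemma primrec_branching : Primrec branching := by
  refine Primrec.ite (Primrec.nat_lt.comp (Primrec.const 1) Primrec.list_length)
    (Primrec.const 2) (Primrec.ite (Primrec.eq.comp (Primrec.nat_mod.comp
      (Primrec.fst.comp Primrec.list_headI) (Primrec.const 2)) (Primrec.const 1))
      (Primrec.const 0) (Primrec.const 1))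

lemma primrec_restr_treeCode (p : ℕ × ℕ) :
    Primrec₂ fun (a : List (Fin 3) × ℕ) j =>
      restr (treeCode (survives (oracle a.1) y a.2) (oracle a.1) y [p]) j := by
  have hA : Primrec₂ fun (b : ((List (Fin 3) × ℕ) × ℕ) × ℕ) (Q : List (ℕ × ℕ)) =>
      advance (survives (oracle b.1.1.1) y b.1.1.2) (oracle b.1.1.1) y Q :=
    Primrec.list_append.comp (Primrec.list_tail.comp Primrec.snd)
      ((primrec_liveSuccs hy).comp (Primrec.fst.comp (Primrec.fst.comp Primrec.fst))
        (Primrec.list_headI.comp Primrec.snd))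
  have hp : Primrec fun _ : ((List (Fin 3) × ℕ) × ℕ) × ℕ => [p] := Primrec.const [p]
  have hn : Primrec fun b : ((List (Fin 3) × ℕ) × ℕ) × ℕ => b.2 := Primrec.snd
  have hQ := Primrec.nat_iterate hn hp hA
  have hL := (primrec_liveSuccs hy).comp (Primrec.fst.comp Primrec.fst)
    (Primrec.list_headI.comp hQ)
  have hB : Primrec₂ fun (a : (List (Fin 3) × ℕ) × ℕ) (j : ℕ) =>
      treeCode (survives (oracle a.1.1) y a.1.2) (oracle a.1.1) y [p] j :=
    primrec_branching.comp hL
  exact Primrec.list_map (Primrec.list_range.comp Primrec.snd) hB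

lemma primrec_survives_oracle {α : Type*} [Primcodable α] {f : α → List (Fin 3)} {m : α → ℕ}
    {p : α → ℕ × ℕ} (hf : Primrec f) (hm : Primrec m) (hp : Primrec p) :
    Primrec fun a => survives (oracle (f a)) y (m a) (p a) := by
  have h : Primrec fun a => ((f a, m a), p a) := Primrec.pair (Primrec.pair hf hm) hp
  have h2 := (primrec_survives hy).comp h
  exact h2

lemma primrec_restr_treeCode_oracle {α : Type*} [Primcodable α] {f : α → List (Fin 3)}
    {m j : α → ℕ} (hf : Primrec f) (hm : Primrec m) (hj : Primrec j) (p : ℕ × ℕ) :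
    Primrec fun a => restr (treeCode (survives (oracle (f a)) y (m a)) (oracle (f a)) y [p])
      (j a) := by
  have h : Primrec fun a => (f a, m a) := Primrec.pair hf hm
  have h2 := (primrec_restr_treeCode hy p).comp h hj
  exact h2

end Computability

lemma primrec_two_pow : Primrec fun n : ℕ => 2 ^ n := by
  refine (Primrec.nat_iterate Primrec.id (Primrec.const 1) (h := fun _ m => 2 * m)
    (Primrec.nat_mul.comp (Primrec.const 2) Primrec.snd)).of_eq fun n => ?_
  induction n with
  | zero => rfl
  | succ n ih => rw [id, Function.iterate_succ_apply', pow_succ', ← ih]; rfl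

/-- Decide the guard `c` first; if it holds, run the semi-decision procedure of `W`, otherwise
diverge. -/
lemma rePred_and_comp {α β : Type*} [Primcodable α] [Primcodable β] {W : β → Prop} (hW : REPred W)
    {c : α → Bool} (hc : Computable c) {g : α → β} (hg : Computable g) :
    REPred fun a => c a = true ∧ W (g a) := by
  refine (Partrec.cond hc (Partrec.comp hW hg) Partrec.none).of_eq fun a => Part.ext fun u => ?_
  cases h : c a <;> simp [h]

/-! ### How much of `x` the finite approximations read. -/

section Use

variable {x x' y : ℕ → Fin 3} {N : ℕ}

lemma succs_congr (h : ∀ n < N, x n = x' n) {p : ℕ × ℕ} (hp : 2 * (p.1 + 2) ≤ N) :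
    succs x y p = succs x' y p := by
  rw [succs, succs, childAt, childAt, childAt, childAt, h _ (by omega), h _ (by omega)]

/-- The shift by 2 makes the growth purely multiplicative, so that `n` steps multiply the bound by
`2 ^ n`. -/
lemma index_le_of_mem_succs {p q : ℕ × ℕ} (hq : q ∈ succs x y p) : q.1 + 2 ≤ 2 * (p.1 + 2) := by
  rcases mem_succs.1 hq with h | h
  · have := (exists_of_mem_childAt h).1; omega
  · have := (exists_of_mem_childAt h).1; omega

lemma survives_congr (h : ∀ n < N, x n = x' n) {n : ℕ} {p : ℕ × ℕ} (hp : 2 ^ n * (p.1 + 2) ≤ N) :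
    survives x y n p = survives x' y n p := by
  induction n generalizing p with
  | zero => simp
  | succ n ih =>
    have h1 : 2 ^ n * (2 * (p.1 + 2)) ≤ N := by rw [← mul_assoc, ← pow_succ]; exact hp
    rw [Bool.eq_iff_iff, survives_succ, survives_succ,
      succs_congr h ((Nat.le_mul_of_pos_left _ (by positivity)).trans h1)]
    refine exists_congr fun q => and_congr_right fun hq => ?_
    rw [ih ((Nat.mul_le_mul_left _ (index_le_of_mem_succs hq)).trans h1)]

lemma liveSuccs_congr (h : ∀ n < N, x n = x' n) {m : ℕ} {p : ℕ × ℕ}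
    (hp : 2 ^ (m + 1) * (p.1 + 2) ≤ N) :
    liveSuccs (survives x y m) x y p = liveSuccs (survives x' y m) x' y p := by
  have h1 : 2 ^ m * (2 * (p.1 + 2)) ≤ N := by rw [← mul_assoc, ← pow_succ]; exact hp
  rw [liveSuccs, liveSuccs, succs_congr h ((Nat.le_mul_of_pos_left _ (by positivity)).trans h1)]
  exact List.filter_congr fun q hq =>
    survives_congr h ((Nat.mul_le_mul_left _ (index_le_of_mem_succs hq)).trans h1)

/-- `M` bounds the shifted positions in the queue. Each of the `j` steps doubles it at most, and the
judgement of the last children contributes `m + 1` further doublings. -/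
lemma treeCode_congr (h : ∀ n < N, x n = x' n) {m j M : ℕ} {Q : List (ℕ × ℕ)} (hM : 2 ≤ M)
    (hQ : ∀ q ∈ Q, q.1 + 2 ≤ M) (hN : 2 ^ (m + 1 + j) * M ≤ N) :
    treeCode (survives x y m) x y Q j = treeCode (survives x' y m) x' y Q j := by
  -- The head of an empty queue is the default `(0, 0)`; this is where `2 ≤ M` enters.
  have hhead : Q.headI.1 + 2 ≤ M := by
    cases Q with
    | nil => exact hM
    | cons q Q => exact hQ q (by simp)
  have hl : liveSuccs (survives x y m) x y Q.headI = liveSuccs (survives x' y m) x' y Q.headI := by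
    refine liveSuccs_congr h (le_trans ?_ hN)
    exact Nat.mul_le_mul (Nat.pow_le_pow_right (by norm_num) (by omega)) hhead
  induction j generalizing Q M with
  | zero => rw [treeCode_zero, treeCode_zero, hl]
  | succ j ih =>
    have ha : advance (survives x y m) x y Q = advance (survives x' y m) x' y Q := by
      rw [advance, advance, hl]
    rw [treeCode_succ, treeCode_succ, ← ha]
    have hQ' : ∀ q ∈ advance (survives x y m) x y Q, q.1 + 2 ≤ 2 * M := by
      intro q hq
      rcases List.mem_append.1 hq with hq | hq
      · have := hQ q (List.mem_of_mem_tail hq); omega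
      · have := index_le_of_mem_succs (List.mem_filter.1 hq).1; omega
    have hN' : 2 ^ (m + 1 + j) * (2 * M) ≤ N := by
      rw [← mul_assoc, ← pow_succ]; exact hN
    have hh : (advance (survives x y m) x y Q).headI.1 + 2 ≤ 2 * M := by
      generalize advance (survives x y m) x y Q = R at hQ'
      cases R with
      | nil => exact (by omega : 0 + 2 ≤ 2 * M)
      | cons q R => exact hQ' q (by simp)
    refine ih (by omega) hQ' hN' hh (liveSuccs_congr h (le_trans ?_ hN'))
    exact Nat.mul_le_mul (Nat.pow_le_pow_right (by norm_num) (by omega)) hh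

lemma restr_treeCode_congr (h : ∀ n < N, x n = x' n) {m j : ℕ} {p : ℕ × ℕ}
    (hN : 2 ^ (m + j + 1) * (p.1 + 2) ≤ N) :
    restr (treeCode (survives x y m) x y [p]) j = restr (treeCode (survives x' y m) x' y [p]) j := by
  refine List.map_congr_left fun i hi => ?_
  rw [List.mem_range] at hi
  refine treeCode_congr h (M := p.1 + 2) (by omega) (by simp) (le_trans ?_ hN)
  exact Nat.mul_le_mul_right _ (Nat.pow_le_pow_right (by norm_num) (by omega))

end Use

/-! ### Correctness of the approximate code, and the error of a finite lookahead. -/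

section Approximation

/-- The nodes that may be generated in `j` steps from the queue `R`. -/
def candidates : ℕ → List (ℕ × ℕ) → List (ℕ × ℕ)
  | 0, R => R
  | j + 1, R => candidates j (R ++ R.flatMap fun p =>
      [childNode p 0 0, childNode p 0 1, childNode p 1 0, childNode p 1 1])

/-- Each step keeps a node and adds four: two directions, and for each the two possible counts of
matched digits. The list does not depend on `x`, which permits a union bound over it. -/
lemma length_candidates (j : ℕ) (R : List (ℕ × ℕ)) :
    (candidates j R).length = 5 ^ j * R.length := by
  induction j generalizing R with
  | zero => simp [candidates]
  | succ j ih =>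
    rw [candidates, ih]
    simp [List.length_flatMap]
    ring

lemma subset_candidates (j : ℕ) (R : List (ℕ × ℕ)) : R ⊆ candidates j R := by
  induction j generalizing R with
  | zero => exact List.Subset.refl _
  | succ j ih => exact List.Subset.trans (List.subset_append_left _ _) (ih _)

variable {x y : ℕ → Fin 3}

lemma mem_of_mem_succs {p q : ℕ × ℕ} (hq : q ∈ succs x y p) :
    q ∈ [childNode p 0 0, childNode p 0 1, childNode p 1 0, childNode p 1 1] := by
  rcases mem_succs.1 hq with h | h <;> obtain ⟨-, e, -, rfl⟩ := exists_of_mem_childAt h <;>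
    fin_cases e <;> simp [childNode]

/-- All children judged in the first `j` steps are candidates, so if the lookahead is right about
the candidates, both generations run through the same queues. -/
lemma treeCode_survives_eq {m j : ℕ} {Q R : List (ℕ × ℕ)} (hQ : Q ≠ [])
    (hS : ∀ p ∈ Q, Survives x y p) (hQR : Q ⊆ R)
    (h : ∀ q ∈ candidates j R, survives x y m q = immortal x y q) {i : ℕ} (hi : i < j) :
    treeCode (survives x y m) x y Q i = treeCode (immortal x y) x y Q i := by
  induction j generalizing Q R i with
  | zero => omega
  | succ j ih =>
    obtain ⟨p, Q, rfl⟩ := List.exists_cons_of_ne_nil hQ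
    have hsub : ∀ q ∈ succs x y p, q ∈ R ++ R.flatMap fun p =>
        [childNode p 0 0, childNode p 0 1, childNode p 1 0, childNode p 1 1] := fun q hq =>
      List.mem_append_right _ (List.mem_flatMap.2 ⟨p, hQR (by simp), mem_of_mem_succs hq⟩)
    have hl : liveSuccs (survives x y m) x y p = liveSuccs (immortal x y) x y p :=
      List.filter_congr fun q hq => h q (subset_candidates j _ (hsub q hq))
    cases i with
    | zero => rw [treeCode_zero, treeCode_zero, List.headI_cons, hl]
    | succ i =>
      rw [treeCode_succ, treeCode_succ, advance_cons, advance_cons, hl, ← advance_cons]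
      have ha := advance_immortal hQ hS
      refine ih ha.1 ha.2 (fun q hq => ?_) h (by omega)
      rw [advance_cons] at hq
      rcases List.mem_append.1 hq with hq | hq
      · exact List.mem_append_left _ (hQR (by simp [hq]))
      · exact hsub q (List.mem_filter.1 hq).1

lemma restr_treeCode_survives_eq {m j : ℕ} {p : ℕ × ℕ} (hS : Survives x y p)
    (h : ∀ q ∈ candidates j [p], survives x y m q = immortal x y q) :
    restr (treeCode (survives x y m) x y [p]) j = restr (treeCode (immortal x y) x y [p]) j :=
  List.map_congr_left fun _ hi => treeCode_survives_eq (by simp) (by simpa using hS)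
    (List.Subset.refl _) h (List.mem_range.1 hi)

lemma eventually_survives_eq_on (l : List (ℕ × ℕ)) :
    ∀ᶠ m in Filter.atTop, ∀ q ∈ l, survives x y m q = immortal x y q :=
  (List.finite_toSet l).eventually_all.2 fun q _ => eventually_survives_eq_immortal q

lemma measure_exists_mem_le {P : ℕ × ℕ → InfSeq 3 → Prop} {r : ℝ≥0∞}
    (h : ∀ q, lebesgue 3 {x | P q x} ≤ r) (l : List (ℕ × ℕ)) :
    lebesgue 3 {x | ∃ q ∈ l, P q x} ≤ l.length * r := by
  induction l with
  | nil => simp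
  | cons q l ih =>
    have : {x : InfSeq 3 | ∃ q' ∈ q :: l, P q' x} = {x | P q x} ∪ {x | ∃ q ∈ l, P q x} := by
      ext x; simp
    rw [this, List.length_cons, Nat.cast_succ, add_mul, one_mul, add_comm]
    exact (measure_union_le _ _).trans (add_le_add (h q) ih)

/-- With sufficient lookahead, all candidate nodes are likely to be classified correctly. -/
lemma lebesgue_misjudged_le (hy : ∀ c, y c ≠ 2) (k j : ℕ) (p : ℕ × ℕ) :
    lebesgue 3 {x | ∃ q ∈ candidates j [p],
      survives x y (2 * (k + 4 * j)) q = true ∧ ¬ Survives x y q} ≤ 2⁻¹ ^ (k + j + 2) := by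
  refine (measure_exists_mem_le (r := ENNReal.ofReal (1 / 4 * (2 / 3) ^ (2 * (k + 4 * j))))
    (fun q => ?_) _).trans ?_
  · rw [← ENNReal.ofReal_toReal (measure_ne_top (lebesgue 3) _)]
    exact ENNReal.ofReal_le_ofReal (lebesgue_survives_not_forever hy _ q)
  · have h1 : (2⁻¹ : ℝ≥0∞) ^ (k + j + 2) = ENNReal.ofReal ((1 / 2) ^ (k + j + 2)) := by
      rw [ENNReal.ofReal_pow (by norm_num), one_div, ENNReal.ofReal_inv_of_pos (by norm_num)]
      simp
    rw [h1, length_candidates, ← ENNReal.ofReal_natCast, ← ENNReal.ofReal_mul (by positivity)]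
    refine ENNReal.ofReal_le_ofReal ?_
    -- The doubling in the lookahead is used for (2/3)^2 ≤ 1/2. Of the exponent `k + 4 * j`, the
    -- part `3 * j` pays for the `5 ^ j ≤ 8 ^ j` candidates; the factor 1/4 supplies the `+ 2`.
    have h2 : ((2 : ℝ) / 3) ^ (2 * (k + 4 * j)) ≤ (1 / 2) ^ (k + 4 * j) := by
      rw [pow_mul]
      exact pow_le_pow_left₀ (by norm_num) (by norm_num) _
    have h3 : (5 : ℝ) ^ j ≤ 8 ^ j := pow_le_pow_left₀ (by norm_num) (by norm_num) _
    have h4 : (8 : ℝ) ^ j * (1 / 2) ^ (k + 4 * j) = (1 / 2) ^ (k + j) := by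
      rw [show k + 4 * j = (k + j) + 3 * j by ring, pow_add, pow_mul (1 / 2 : ℝ) 3, mul_left_comm,
        ← mul_pow]
      norm_num
    push_cast
    simp only [List.length_singleton, Nat.cast_one, mul_one]
    calc (5 : ℝ) ^ j * (1 / 4 * (2 / 3) ^ (2 * (k + 4 * j)))
        ≤ 8 ^ j * (1 / 4 * (1 / 2) ^ (k + 4 * j)) := by gcongr
      _ = (1 / 2) ^ (k + j + 2) := by rw [mul_left_comm, h4, pow_add _ (k + j)]; ring

end Approximation

/-! ### Pulling tests back along the code, and consequences of randomness. -/

section Randomness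

/-- A random sequence avoids some level of every test. -/
lemma exists_notMem_of_mem_MLR {n : ℕ} [NeZero n] {x : InfSeq n} (hx : x ∈ MLR n)
    {W : ℕ × List (Fin n) → Prop} (hW : REPred W)
    (hm : ∀ k, lebesgue n (openSet fun σ => W (k, σ)) ≤ 2⁻¹ ^ k) :
    ∃ k, ∀ L, ¬ W (k, restr x L) := by
  have := hx _ ⟨⟨W, hW, fun k => rfl⟩, hm⟩
  rw [Set.mem_iInter, not_forall] at this
  obtain ⟨k, hk⟩ := this
  exact ⟨k, fun L h => hk ⟨L, h⟩⟩

lemma rePred_of_primrec {α : Type*} [Primcodable α] {c : α → Bool} (hc : Primrec c) :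
    REPred fun a => c a = true := by
  have h : REPred fun _ : α => True := (ComputablePred.computable_iff.2
    ⟨fun _ => true, Computable.const _, by simp⟩).to_re
  exact (rePred_and_comp h hc.to_comp Computable.id).of_eq fun a => by simp

lemma ofReal_le_inv_two_pow {r : ℝ} {k : ℕ} (h : r ≤ (1 / 2) ^ k) :
    ENNReal.ofReal r ≤ 2⁻¹ ^ k := by
  refine (ENNReal.ofReal_le_ofReal h).trans (le_of_eq ?_)
  rw [ENNReal.ofReal_pow (by norm_num), one_div, ENNReal.ofReal_inv_of_pos (by norm_num)]
  simp

lemma lebesgue_le_inv_two_pow {A : Set (InfSeq 3)} {k : ℕ}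
    (h : (lebesgue 3).real A ≤ (1 / 2) ^ k) : lebesgue 3 A ≤ 2⁻¹ ^ k := by
  rw [← ENNReal.ofReal_toReal (measure_ne_top (lebesgue 3) A)]
  exact ofReal_le_inv_two_pow h

variable {x y : ℕ → Fin 3}

/-- The strings in `W` without a proper initial segment in `W`. -/
def minimalStrings (W : List (Fin 3) → Prop) : Set (List (Fin 3)) :=
  {ρ | W ρ ∧ ∀ i < ρ.length, ¬ W (ρ.take i)}

lemma take_restr {n : ℕ} (z : InfSeq n) {i k : ℕ} (h : i ≤ k) : (restr z k).take i = restr z i := by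
  rw [restr, ← List.map_take, List.take_range, min_eq_left h, restr]

lemma exists_minimal_of_mem_openSet {W : List (Fin 3) → Prop} {z : InfSeq 3}
    (hz : z ∈ openSet W) : ∃ ρ ∈ minimalStrings W, restr z ρ.length = ρ := by
  classical
  have hz : ∃ k, W (restr z k) := hz
  refine ⟨restr z (Nat.find hz), ⟨Nat.find_spec hz, fun i hi => ?_⟩, by simp⟩
  rw [length_restr] at hi
  rw [take_restr z hi.le]
  exact Nat.find_min hz hi

lemma minimalStrings_disjoint (W : List (Fin 3) → Prop) :
    (minimalStrings W).PairwiseDisjoint fun ρ => {z : InfSeq 3 | restr z ρ.length = ρ} := by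
  have key : ∀ ρ ∈ minimalStrings W, ∀ ρ' ∈ minimalStrings W, ∀ z : InfSeq 3,
      restr z ρ.length = ρ → restr z ρ'.length = ρ' → ρ.length ≤ ρ'.length → ρ = ρ' := by
    intro ρ hρ ρ' hρ' z h h' hle
    rcases hle.eq_or_lt with he | hlt
    · rw [← h, ← h', he]
    · refine absurd hρ.1 ?_
      have := hρ'.2 _ hlt
      rwa [← h', take_restr z hle, h] at this
  intro ρ hρ ρ' hρ' hne
  refine Set.disjoint_left.2 fun z h h' => hne ?_
  rcases le_total ρ.length ρ'.length with hl | hl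
  · exact key ρ hρ ρ' hρ' z h h' hl
  · exact (key ρ' hρ' ρ hρ z h' h hl).symm

/-- The cylinder estimate passes to open sets through the minimal strings: their cylinders are
disjoint, so their measures add up to at most that of the open set, while subadditivity suffices on
the side of `x`. -/
lemma lebesgue_treeCode_mem_openSet_le (hy : ∀ c, y c ≠ 2) (p : ℕ × ℕ) (W : List (Fin 3) → Prop) :
    lebesgue 3 {x | Survives x y p ∧ treeCode (immortal x y) x y [p] ∈ openSet W} ≤
      lebesgue 3 (openSet W) := by
  calc _ ≤ lebesgue 3 (⋃ ρ ∈ minimalStrings W, codeEvent y ρ [p]) := by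
        refine measure_mono ?_
        rintro x ⟨h1, h2⟩
        obtain ⟨ρ, hρ, h⟩ := exists_minimal_of_mem_openSet h2
        exact Set.mem_biUnion hρ ⟨by simpa using h1, h⟩
    _ ≤ ∑' ρ : minimalStrings W, lebesgue 3 (codeEvent y ρ [p]) :=
        measure_biUnion_le _ (Set.to_countable _) _
    _ ≤ ∑' ρ : minimalStrings W, lebesgue 3 {z | restr z ρ.1.length = ρ.1} :=
        ENNReal.tsum_le_tsum fun ρ => lebesgue_codeEvent_le hy ρ.1 p
    _ = lebesgue 3 (⋃ ρ ∈ minimalStrings W, {z | restr z ρ.length = ρ}) :=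
        (measure_biUnion (Set.to_countable _) (minimalStrings_disjoint W)
          fun ρ _ => measurableSet_cylinder ρ).symm
    _ ≤ _ := by
        refine measure_mono (Set.iUnion₂_subset fun ρ hρ z hz => ?_)
        exact ⟨ρ.length, by rw [show restr z ρ.length = ρ from hz]; exact hρ.1⟩

/-- The event that a string `ρ` in `V` of some length `j` is seen to be an initial segment of the
code of the tree above `p`, judged with lookahead at least `2 (k + 4 j)`. -/
def apparentCode (y : ℕ → Fin 3) (p : ℕ × ℕ) (V : List (Fin 3) → Prop) (k : ℕ) :
    Set (InfSeq 3) :=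
  {x | ∃ j m, 2 * (k + 4 * j) ≤ m ∧ survives x y m p = true ∧
    V (restr (treeCode (survives x y m) x y [p]) j)}

lemma tsum_inv_two_pow (k : ℕ) : ∑' j : ℕ, (2⁻¹ : ℝ≥0∞) ^ (k + j + 2) = 2⁻¹ ^ (k + 1) := by
  have : ∀ j : ℕ, (2⁻¹ : ℝ≥0∞) ^ (k + j + 2) = 2⁻¹ ^ (k + 1) * (2⁻¹ * 2⁻¹ ^ j) := fun j => by
    rw [← pow_succ', ← pow_add]; congr 1; ring
  simp_rw [this]
  rw [ENNReal.tsum_mul_left, ENNReal.tsum_mul_left, ENNReal.tsum_geometric,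
    ENNReal.one_sub_inv_two, inv_inv, ENNReal.inv_mul_cancel (by norm_num) (by norm_num), mul_one]

/-- Either no candidate is misjudged, and the string seen is a true initial segment of the code, or
some candidate is misjudged for some `j`. Each alternative has measure at most 2^{-(k+1)}, the
second by summing 2^{-(k+j+2)} over `j`. -/
lemma lebesgue_apparentCode_le (hy : ∀ c, y c ≠ 2) (p : ℕ × ℕ) (V : List (Fin 3) → Prop) (k : ℕ)
    (hV : lebesgue 3 (openSet V) ≤ 2⁻¹ ^ (k + 1)) :
    lebesgue 3 (apparentCode y p V k) ≤ 2⁻¹ ^ k := by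
  have hsub : apparentCode y p V k ⊆
      {x | Survives x y p ∧ treeCode (immortal x y) x y [p] ∈ openSet V} ∪
      ⋃ j : ℕ, {x | ∃ q ∈ candidates j [p],
        survives x y (2 * (k + 4 * j)) q = true ∧ ¬ Survives x y q} := by
    rintro x ⟨j, m, hm, hs, hV⟩
    -- Errors are counted at the least admissible lookahead. Since survival is decreasing in the
    -- lookahead, this covers every larger `m` with a single bad event for each `j`.
    by_cases hbad : ∃ q ∈ candidates j [p],
        survives x y (2 * (k + 4 * j)) q = true ∧ ¬ Survives x y q
    · exact Or.inr (Set.mem_iUnion.2 ⟨j, hbad⟩)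
    · left
      push Not at hbad
      have hcand : ∀ q ∈ candidates j [p], survives x y m q = immortal x y q := by
        intro q hq
        rw [Bool.eq_iff_iff, immortal_eq_true]
        exact ⟨fun h => hbad q hq (survives_of_le hm h), fun h => h m⟩
      have hp : Survives x y p := hbad p (subset_candidates j _ (by simp)) (survives_of_le hm hs)
      rw [restr_treeCode_survives_eq hp hcand] at hV
      exact ⟨hp, j, hV⟩
  refine (measure_mono hsub).trans ((measure_union_le _ _).trans ?_)
  have h1 := (measure_iUnion_le (μ := lebesgue 3) fun j : ℕ => {x | ∃ q ∈ candidates j [p],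
    survives x y (2 * (k + 4 * j)) q = true ∧ ¬ Survives x y q}).trans
    ((ENNReal.tsum_le_tsum fun j => lebesgue_misjudged_le hy k j p).trans
      (tsum_inv_two_pow k).le)
  refine (add_le_add ((lebesgue_treeCode_mem_openSet_le hy p V).trans hV) h1).trans (le_of_eq ?_)
  rw [← two_mul, pow_succ', ← mul_assoc, ENNReal.mul_inv_cancel (by norm_num) (by norm_num),
    one_mul]

/-- The number `j` of digits that a string of length `L` is used to compute. -/
def codeLength (L : ℕ) : ℕ := L.unpair.1.unpair.1

/-- The lookahead that a string of length `L` is used for. -/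
def lookahead (L : ℕ) : ℕ := L.unpair.1.unpair.2

/-- The length of a string encodes the parameters `j` and `m`, so membership in a set generated by
strings amounts to a search over all of them. The remaining component of the pairing makes the
string as long as desired. -/
lemma exists_codeLength_lookahead (j m N : ℕ) :
    ∃ L, codeLength L = j ∧ lookahead L = m ∧ N ≤ L :=
  ⟨Nat.pair (Nat.pair j m) N, by simp [codeLength], by simp [lookahead], Nat.right_le_pair _ _⟩

lemma primrec_codeLength : Primrec codeLength :=
  Primrec.fst.comp (Primrec.unpair.comp (Primrec.fst.comp Primrec.unpair))

lemma primrec_lookahead : Primrec lookahead :=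
  Primrec.snd.comp (Primrec.unpair.comp (Primrec.fst.comp Primrec.unpair))

/-- Whether the string `τ` is long enough for the computation that it is used for, and that
computation has the required lookahead. -/
def admissible (y : ℕ → Fin 3) (p : ℕ × ℕ) (a : ℕ × List (Fin 3)) : Bool :=
  decide (2 * (a.1 + 4 * codeLength a.2.length) ≤ lookahead a.2.length) &&
    (decide (2 ^ (lookahead a.2.length + codeLength a.2.length + 1) * (p.1 + 2) ≤ a.2.length) &&
      survives (oracle a.2) y (lookahead a.2.length) p)

lemma primrec_admissible (hy : Primrec y) (p : ℕ × ℕ) : Primrec (admissible y p) := by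
  have hL : Primrec fun a : ℕ × List (Fin 3) => a.2.length :=
    Primrec.list_length.comp Primrec.snd
  have hj := primrec_codeLength.comp hL
  have hm := primrec_lookahead.comp hL
  refine Primrec.and.comp (PrimrecPred.decide ?_) (Primrec.and.comp (PrimrecPred.decide ?_) ?_)
  · exact Primrec.nat_le.comp (Primrec.nat_mul.comp (Primrec.const 2)
      (Primrec.nat_add.comp Primrec.fst (Primrec.nat_mul.comp (Primrec.const 4) hj))) hm
  · exact Primrec.nat_le.comp (Primrec.nat_mul.comp (primrec_two_pow.comp
      (Primrec.succ.comp (Primrec.nat_add.comp hm hj))) (Primrec.const _)) hL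
  · exact primrec_survives_oracle hy Primrec.snd hm (Primrec.const p)

/-- An admissible string is longer than the use of the computation, so the computation has the same
result with the string as with `x`. This presents the pulled-back test by strings. -/
lemma apparentCode_eq_openSet (p : ℕ × ℕ) (V : List (Fin 3) → Prop) (k : ℕ) :
    apparentCode y p V k = openSet fun τ => admissible y p (k, τ) = true ∧
      V (restr (treeCode (survives (oracle τ) y (lookahead τ.length)) (oracle τ) y [p])
        (codeLength τ.length)) := by
  ext x
  have hagree : ∀ L, ∀ n < L, oracle (restr x L) n = x n := fun L n h => oracle_restr x h
  have hle : ∀ m j, 2 ^ m * (p.1 + 2) ≤ 2 ^ (m + j + 1) * (p.1 + 2) := fun m j =>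
    Nat.mul_le_mul_right _ (Nat.pow_le_pow_right (by norm_num) (by omega))
  constructor
  · rintro ⟨j, m, hm, hs, hV⟩
    obtain ⟨L, rfl, rfl, hL⟩ := exists_codeLength_lookahead j m (2 ^ (m + j + 1) * (p.1 + 2))
    refine ⟨L, ?_, ?_⟩
    · simp only [admissible, length_restr, Bool.and_eq_true, decide_eq_true_eq]
      refine ⟨hm, hL, ?_⟩
      rwa [survives_congr (hagree L) ((hle _ _).trans hL)]
    · rwa [length_restr, restr_treeCode_congr (hagree L) hL]
  · rintro ⟨L, ha, hV⟩
    simp only [admissible, length_restr, Bool.and_eq_true, decide_eq_true_eq] at ha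
    obtain ⟨hm, hL, hs⟩ := ha
    rw [survives_congr (hagree L) ((hle _ _).trans hL)] at hs
    rw [length_restr, restr_treeCode_congr (hagree L) hL] at hV
    exact ⟨_, _, hm, hs, hV⟩

/-- The code of the tree of consistent nodes with infinitely many successors is random. -/
theorem treeCode_mem_MLR (hx : x ∈ MLR 3) (hyp : Primrec y) (hy : ∀ c, y c ≠ 2) {p : ℕ × ℕ}
    (hp : Survives x y p) : treeCode (immortal x y) x y [p] ∈ MLR 3 := by
  rintro U ⟨⟨W, hW, hU⟩, hm⟩ hmem
  -- Level `k` of the new test uses level `k + 1` of the given one; the other half of the measure is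
  -- reserved for misjudgements.
  have hre : REPred fun a : ℕ × List (Fin 3) => admissible y p a = true ∧
      W (a.1 + 1, restr (treeCode (survives (oracle a.2) y (lookahead a.2.length)) (oracle a.2) y
        [p]) (codeLength a.2.length)) := by
    have hL : Primrec fun a : ℕ × List (Fin 3) => a.2.length :=
      Primrec.list_length.comp Primrec.snd
    refine rePred_and_comp hW (primrec_admissible hyp p).to_comp (Primrec.to_comp ?_)
    exact Primrec.pair (Primrec.succ.comp Primrec.fst) (primrec_restr_treeCode_oracle hyp
      Primrec.snd (primrec_lookahead.comp hL) (primrec_codeLength.comp hL) p)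
  obtain ⟨k, hk⟩ := exists_notMem_of_mem_MLR hx hre fun k => by
    have := lebesgue_apparentCode_le hy p (fun σ => W (k + 1, σ)) k (hU (k + 1) ▸ hm (k + 1))
    rwa [apparentCode_eq_openSet] at this
  have hnot : x ∉ apparentCode y p (fun σ => W (k + 1, σ)) k := by
    rw [apparentCode_eq_openSet]
    rintro ⟨L, hL⟩
    exact hk L hL
  refine hnot ?_
  have := Set.mem_iInter.1 hmem (k + 1)
  rw [hU] at this
  obtain ⟨j, hj⟩ := this
  -- A lookahead that is both correct on the candidates and large enough shows the true initial
  -- segment of length `j`.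
  obtain ⟨m, hm1, hm2⟩ := ((eventually_survives_eq_on (x := x) (y := y)
    (candidates j [p])).and (Filter.eventually_ge_atTop (2 * (k + 4 * j)))).exists
  exact ⟨j, m, hm2, hp m, by rwa [restr_treeCode_survives_eq hp hm1]⟩

/-- A random sequence contains the digit `2`. -/
lemma exists_eq_two_of_mem_MLR {z : InfSeq 3} (hz : z ∈ MLR 3) : ∃ n, z n = 2 := by
  by_contra! h
  -- Level `k` consists of the strings of length `2 * k` without `2`; its measure is (4/9)^k.
  have hre : REPred fun a : ℕ × List (Fin 3) =>
      (decide (a.2.length = 2 * a.1) && decide (∀ d ∈ a.2, d ≠ 2)) = true := by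
    refine rePred_of_primrec (Primrec.and.comp (PrimrecPred.decide ?_) (PrimrecPred.decide ?_))
    · exact Primrec.eq.comp (Primrec.list_length.comp Primrec.snd)
        (Primrec.nat_mul.comp (Primrec.const 2) Primrec.fst)
    · exact (PrimrecPred.forall_mem_list
        (PrimrecPred.not (Primrec.eq.comp Primrec.id (Primrec.const 2)))).comp Primrec.snd
  obtain ⟨k, hk⟩ := exists_notMem_of_mem_MLR hz hre fun k => by
    refine lebesgue_le_inv_two_pow ?_
    have hfin : ∀ n : ℕ, MeasurableSet[coordsAlgebra (Set.Iio n)]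
        {z : InfSeq 3 | ∀ i < n, z i ≠ 2} ∧
        (lebesgue 3).real {z : InfSeq 3 | ∀ i < n, z i ≠ 2} = (2 / 3) ^ n := by
      intro n
      induction n with
      | zero => simp
      | succ n ih =>
        have : {z : InfSeq 3 | ∀ i < n + 1, z i ≠ 2} =
            {z | ∀ i < n, z i ≠ 2} ∩ {z | z n = 2}ᶜ := by
          ext z
          simp only [Order.lt_add_one_iff, Set.mem_ofPred_eq, Set.mem_inter_iff, Set.mem_compl_iff]
          exact ⟨fun h => ⟨fun i hi => h i hi.le, h n le_rfl⟩, fun h i hi =>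
            hi.lt_or_eq.elim (h.1 i) fun e => e ▸ h.2⟩
        rw [this]
        constructor
        · exact (measurableSet_mono (Set.Iio_subset_Iio (Nat.le_succ n)) ih.1).inter
            (measurableSet_mono (by simp) (measurableSet_coord n 2)).compl
        · rw [lebesgue_inter (by simp) ih.1 (measurableSet_coord n 2).compl, ih.2,
            probReal_compl_eq_one_sub (measurableSet_of_coords (measurableSet_coord n 2)),
            lebesgue_coord, pow_succ]
          norm_num
    calc _ ≤ (lebesgue 3).real {z : InfSeq 3 | ∀ i < 2 * k, z i ≠ 2} := by
          refine measureReal_mono ?_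
          rintro z ⟨L, hL⟩
          simp only [length_restr, Bool.and_eq_true, decide_eq_true_eq] at hL
          obtain ⟨rfl, hL⟩ := hL
          exact fun i hi => hL _ (List.mem_map_of_mem (List.mem_range.2 hi))
      _ = ((2 / 3) ^ 2) ^ k := by rw [(hfin _).2, pow_mul]
      _ ≤ _ := pow_le_pow_left₀ (by norm_num) (by norm_num) _
  refine hk (2 * k) ?_
  simp only [length_restr, Bool.and_eq_true, decide_eq_true_eq, true_and]
  intro d hd
  obtain ⟨i, -, rfl⟩ := List.mem_map.1 hd
  exact h i

/-- Above every node, the tree of nodes reached over labels `2` only is finite. -/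
lemma not_survives_two (hx : x ∈ MLR 3) (p : ℕ × ℕ) : ¬ Survives x (fun _ => 2) p := by
  intro h
  -- Level `k` asks for survival over `2 * k` levels, of probability at most (4/9)^k, as seen by a
  -- string longer than the use.
  have hre : REPred fun a : ℕ × List (Fin 3) =>
      (decide (2 ^ (2 * a.1) * (p.1 + 2) ≤ a.2.length) &&
        survives (oracle a.2) (fun _ => 2) (2 * a.1) p) = true := by
    have h2 : Primrec fun a : ℕ × List (Fin 3) => 2 * a.1 :=
      Primrec.nat_mul.comp (Primrec.const 2) Primrec.fst
    refine rePred_of_primrec (Primrec.and.comp (PrimrecPred.decide ?_) ?_)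
    · exact Primrec.nat_le.comp (Primrec.nat_mul.comp (primrec_two_pow.comp h2)
        (Primrec.const _)) (Primrec.list_length.comp Primrec.snd)
    · exact primrec_survives_oracle (Primrec.const 2) Primrec.snd h2 (Primrec.const p)
  obtain ⟨k, hk⟩ := exists_notMem_of_mem_MLR hx hre fun k => by
    refine lebesgue_le_inv_two_pow ?_
    calc _ ≤ (lebesgue 3).real {x | survives x (fun _ => 2) (2 * k) p = true} := by
          refine measureReal_mono ?_
          rintro x ⟨L, hL⟩
          simp only [length_restr, Bool.and_eq_true, decide_eq_true_eq] at hL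
          rw [survives_congr (fun n h => oracle_restr x h) hL.1] at hL
          exact hL.2
      _ ≤ ((2 / 3) ^ 2) ^ k := by rw [← pow_mul]; exact lebesgue_survives_two _ p
      _ ≤ _ := pow_le_pow_left₀ (by norm_num) (by norm_num) _
  refine hk (2 ^ (2 * k) * (p.1 + 2)) ?_
  simp only [length_restr, Bool.and_eq_true, decide_eq_true_eq, le_refl, true_and]
  rw [survives_congr (fun n h => oracle_restr x h) le_rfl]
  exact h _

end Randomness

/-! ### A surviving node off the rightmost path. -/

section Existence

/-- The left child of the rightmost node at level `j`. -/
def leftOfSpine (j : ℕ) : ℕ × ℕ := (2 * (2 ^ (j + 1) - 2) + 1, 0)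

/-- The first `k` nodes hanging to the left of the rightmost path. -/
def spineNodes (k : ℕ) : List (ℕ × ℕ) := (List.range k).map leftOfSpine

lemma primrec_spineNodes : Primrec spineNodes := by
  refine Primrec.list_map Primrec.list_range ?_
  refine Primrec.pair (Primrec.succ.comp (Primrec.nat_mul.comp (Primrec.const 2)
    (Primrec.nat_sub.comp (primrec_two_pow.comp (Primrec.succ.comp Primrec.snd))
      (Primrec.const 2)))) (Primrec.const 0)

variable {x y : ℕ → Fin 3}

/-- The rightmost node at level `k` has position `2 ^ (k + 1) - 2`. The first `k` side subtrees use
no coordinate above it, whereas the next one uses only such coordinates, so each contributes an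
independent factor 1 - 3/4. The measurability clause carries the induction. -/
lemma lebesgue_forall_not_survives (hy : ∀ c, y c ≠ 2) (k : ℕ) :
    MeasurableSet[coordsAlgebra (above (2 ^ (k + 1) - 2))ᶜ]
      {x : InfSeq 3 | ∀ j < k, ¬ Survives x y (leftOfSpine j)} ∧
    (lebesgue 3).real {x | ∀ j < k, ¬ Survives x y (leftOfSpine j)} = (1 / 4) ^ k := by
  induction k with
  | zero => simp
  | succ k ih =>
    have h : {x : InfSeq 3 | ∀ j < k + 1, ¬ Survives x y (leftOfSpine j)} =
        {x | ∀ j < k, ¬ Survives x y (leftOfSpine j)} ∩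
          {x | Survives x y (leftOfSpine k)}ᶜ := by
      ext x
      simp only [Order.lt_add_one_iff, Set.mem_ofPred_eq, Set.mem_inter_iff, Set.mem_compl_iff]
      exact ⟨fun h => ⟨fun i hi => h i hi.le, h k le_rfl⟩, fun h i hi =>
        hi.lt_or_eq.elim (h.1 i) fun e => e ▸ h.2⟩
    have hm := measurableSet_survives_forever (y := y) (leftOfSpine k)
    have hsub := above_child_subset (2 ^ (k + 1) - 2) (b := 0) (by norm_num)
    have hnext : 2 ^ (k + 1 + 1) - 2 = 2 * (2 ^ (k + 1) - 2) + 1 + 1 := by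
      have : 2 ≤ 2 ^ (k + 1) := by
        rw [pow_succ]; exact Nat.le_mul_of_pos_left _ (by positivity)
      rw [pow_succ 2 (k + 1)]
      omega
    rw [h]
    constructor
    · refine (measurableSet_mono ?_ ih.1).inter (measurableSet_mono ?_ hm).compl
      · rw [hnext]
        exact Set.compl_subset_compl.2 (above_child_subset _ (by norm_num))
      · rw [hnext]
        exact Set.subset_compl_iff_disjoint_right.2 (disjoint_above_children _)
    · rw [lebesgue_inter (Set.disjoint_compl_left_iff_subset.2 hsub) ih.1 hm.compl, ih.2,
        probReal_compl_eq_one_sub (measurableSet_of_coords hm), lebesgue_survives_forever hy,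
        pow_succ]
      norm_num

lemma index_le_of_mem_spineNodes {k : ℕ} {q : ℕ × ℕ} (hq : q ∈ spineNodes k) :
    q.1 + 2 ≤ 2 ^ (k + 1) := by
  obtain ⟨j, hj, rfl⟩ := List.mem_map.1 hq
  rw [List.mem_range] at hj
  have h1 : 2 ^ (j + 1 + 1) ≤ 2 ^ (k + 1) := Nat.pow_le_pow_right (by norm_num) (by omega)
  have h2 : 2 ≤ 2 ^ (j + 1) := by
    rw [pow_succ]; exact Nat.le_mul_of_pos_left _ (by positivity)
  rw [pow_succ 2 (j + 1)] at h1
  simp only [leftOfSpine]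
  omega

/-- Some node of a random tree starts an infinite subtree consistent with `y`. -/
lemma exists_survives (hx : x ∈ MLR 3) (hyp : Primrec y) (hy : ∀ c, y c ≠ 2) :
    ∃ i, Survives x y (i, 0) := by
  by_contra! hdead
  -- Extinction of the first `k` side subtrees is visible after finitely many levels, but with no
  -- bound on their number; hence the lookahead is read off the length of the string.
  have hre : REPred fun a : ℕ × List (Fin 3) =>
      (decide (2 ^ lookahead a.2.length * 2 ^ (a.1 + 1) ≤ a.2.length) &&
        decide ((descend (oracle a.2) y (lookahead a.2.length) (spineNodes a.1)).length = 0)) =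
          true := by
    have hL : Primrec fun a : ℕ × List (Fin 3) => a.2.length :=
      Primrec.list_length.comp Primrec.snd
    have hm := primrec_lookahead.comp hL
    have hd : Primrec fun a : ℕ × List (Fin 3) => (a.2, lookahead a.2.length, spineNodes a.1) :=
      Primrec.pair Primrec.snd (Primrec.pair hm (primrec_spineNodes.comp Primrec.fst))
    have hd2 := (primrec_descend hyp).comp hd
    refine rePred_of_primrec (Primrec.and.comp (PrimrecPred.decide ?_) (PrimrecPred.decide ?_))
    · exact Primrec.nat_le.comp (Primrec.nat_mul.comp (primrec_two_pow.comp hm)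
        (primrec_two_pow.comp (Primrec.succ.comp Primrec.fst))) hL
    · exact Primrec.eq.comp (Primrec.list_length.comp hd2) (Primrec.const 0)
  have hiff : ∀ (x : InfSeq 3) k L, 2 ^ lookahead L * 2 ^ (k + 1) ≤ L →
      ((descend (oracle (restr x L)) y (lookahead L) (spineNodes k)).length = 0 ↔
        ∀ q ∈ spineNodes k, survives x y (lookahead L) q = false) := by
    intro x k L hL
    rw [List.length_eq_zero_iff, descend_eq_nil_iff]
    refine forall₂_congr fun q hq => ?_
    rw [survives_congr (fun n h => oracle_restr x h)
      ((Nat.mul_le_mul_left _ (index_le_of_mem_spineNodes hq)).trans hL)]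
  obtain ⟨k, hk⟩ := exists_notMem_of_mem_MLR hx hre fun k => by
    refine lebesgue_le_inv_two_pow ?_
    calc _ ≤ (lebesgue 3).real {x | ∀ j < k, ¬ Survives x y (leftOfSpine j)} := by
          refine measureReal_mono ?_
          rintro x ⟨L, hL⟩
          simp only [length_restr, Bool.and_eq_true, decide_eq_true_eq] at hL
          have := (hiff x k L hL.1).1 hL.2
          intro j hj hs
          have hf := this _ (List.mem_map_of_mem (List.mem_range.2 hj))
          rw [hs] at hf
          exact absurd hf (by simp)
      _ = (1 / 4) ^ k := (lebesgue_forall_not_survives hy k).2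
      _ ≤ _ := pow_le_pow_left₀ (by norm_num) (by norm_num) _
  obtain ⟨m, hm⟩ := (eventually_survives_eq_on (x := x) (y := y) (spineNodes k)).exists
  obtain ⟨L, -, rfl, hL⟩ := exists_codeLength_lookahead 0 m (2 ^ m * 2 ^ (k + 1))
  refine hk L ?_
  simp only [length_restr, Bool.and_eq_true, decide_eq_true_eq]
  refine ⟨hL, (hiff x k L hL).2 fun q hq => ?_⟩
  rw [hm q hq, ← Bool.not_eq_true, immortal_eq_true]
  obtain ⟨j, -, rfl⟩ := List.mem_map.1 hq
  exact hdead _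

end Existence

/-! ### Binary sequences as paths through the tree of nodes. -/

section Paths

lemma stringIndex_append (σ : List (Fin 2)) (b : Fin 2) :
    stringIndex (σ ++ [b]) = 2 * stringIndex σ + 1 + b := by
  simp [stringIndex]

lemma stringIndex_injective : Function.Injective stringIndex := by
  intro σ
  induction σ using List.reverseRecOn with
  | nil =>
    intro τ h
    induction τ using List.reverseRecOn with
    | nil => rfl
    | append_singleton τ b _ =>
      rw [stringIndex_append] at h
      exact absurd h (by simp [stringIndex]; omega)
  | append_singleton σ a ih =>
    intro τ h
    induction τ using List.reverseRecOn with
    | nil =>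
      rw [stringIndex_append] at h
      exact absurd h (by simp [stringIndex])
    | append_singleton τ b _ =>
      rw [stringIndex_append, stringIndex_append] at h
      have ha := a.isLt
      have hb := b.isLt
      rw [ih (show stringIndex σ = stringIndex τ by omega), Fin.ext (show a.val = b.val by omega)]

variable {x y : ℕ → Fin 3}

/-- The node `u ↾ k` together with the number of digits other than `2` among the labels of its
non-empty initial segments. -/
def pathNode (x : ℕ → Fin 3) (u : InfSeq 2) (k : ℕ) : ℕ × ℕ :=
  (stringIndex (restr u k), Nat.count (fun j => labelsAlong x u j ≠ 2) k)

/-- The label of `u ↾ (k + 1)` is consistent with `y`. -/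
def Matches (x y : ℕ → Fin 3) (u : InfSeq 2) (k : ℕ) : Prop :=
  labelsAlong x u k = 2 ∨ labelsAlong x u k = y (pathNode x u k).2

lemma pathNode_zero (u : InfSeq 2) : pathNode x u 0 = (0, 0) := by
  simp [pathNode, restr, stringIndex]

lemma stringIndex_restr_succ (u : InfSeq 2) (k : ℕ) :
    stringIndex (restr u (k + 1)) = 2 * stringIndex (restr u k) + 1 + u k := by
  rw [restr_succ, stringIndex_append]

lemma labelsAlong_eq (u : InfSeq 2) (k : ℕ) :
    labelsAlong x u k = x (2 * (pathNode x u k).1 + u k) := by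
  rw [labelsAlong, label, stringIndex_restr_succ]
  congr 1
  simp only [pathNode]
  omega

lemma pathNode_succ (u : InfSeq 2) (k : ℕ) :
    pathNode x u (k + 1) = (2 * (pathNode x u k).1 + 1 + u k,
      (pathNode x u k).2 + if labelsAlong x u k ≠ 2 then 1 else 0) := by
  rw [pathNode, stringIndex_restr_succ, Nat.count_succ]; rfl

lemma restr_congr {n : ℕ} {u v : InfSeq n} {k : ℕ} (h : ∀ j < k, u j = v j) :
    restr u k = restr v k :=
  List.map_congr_left fun j hj => h j (List.mem_range.1 hj)

lemma eq_of_restr_eq {n : ℕ} {u v : InfSeq n} {k : ℕ} (h : restr u k = restr v k) :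
    ∀ j < k, u j = v j := fun j hj =>
  List.map_inj_left.1 h j (List.mem_range.2 hj)

lemma labelsAlong_congr {u v : InfSeq 2} {k : ℕ} (h : ∀ j < k, u j = v j) {j : ℕ} (hj : j < k) :
    labelsAlong x u j = labelsAlong x v j := by
  rw [labelsAlong, labelsAlong, restr_congr fun i hi => h i (by omega)]

lemma pathNode_congr {u v : InfSeq 2} {k : ℕ} (h : ∀ j < k, u j = v j) :
    pathNode x u k = pathNode x v k := by
  induction k with
  | zero => rw [pathNode_zero, pathNode_zero]
  | succ k ih =>
    rw [pathNode_succ, pathNode_succ, ih fun j hj => h j (by omega),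
      labelsAlong_congr h k.lt_succ_self, h k k.lt_succ_self]

lemma Matches.congr {u v : InfSeq 2} {k : ℕ} (h : ∀ j ≤ k, u j = v j) (hm : Matches x y u k) :
    Matches x y v k := by
  rw [Matches, ← labelsAlong_congr (u := u) (v := v) (k := k + 1) (fun j hj => h j (by omega))
    k.lt_succ_self, ← pathNode_congr (u := u) (v := v) fun j hj => h j hj.le]
  exact hm

lemma Matches.mem_succs {u : InfSeq 2} {k : ℕ} (h : Matches x y u k) :
    pathNode x u (k + 1) ∈ succs x y (pathNode x u k) := by
  have hc : pathNode x u (k + 1) ∈ childAt x y (u k) (pathNode x u k) := by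
    rw [pathNode_succ, childAt, ← labelsAlong_eq (x := x) u k]
    by_cases h2 : labelsAlong x u k = 2
    · simp [h2]
    · have := h.resolve_left h2
      simp [h2, ← this]
  rw [FiberTree.mem_succs]
  have : u k = 0 ∨ u k = 1 := by omega
  rcases this with h0 | h0 <;> rw [h0] at hc
  · exact Or.inl hc
  · exact Or.inr hc

lemma matches_of_mem_childAt {u : InfSeq 2} {k : ℕ} {b : ℕ} (hb : u k = b) {q : ℕ × ℕ}
    (hq : q ∈ childAt x y b (pathNode x u k)) :
    Matches x y u k ∧ pathNode x u (k + 1) = q := by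
  rw [childAt, ← hb, ← labelsAlong_eq (x := x) u k] at hq
  rw [Matches, pathNode_succ]
  split_ifs at hq with h1 h2
  · rw [List.mem_singleton.1 hq]; simp [h1]
  · rw [List.mem_singleton.1 hq, if_pos h1]; exact ⟨Or.inr h2, rfl⟩
  · simp at hq

/-- A consistent child of `u ↾ k` in direction `b` lies on a path through `u ↾ k`. -/
lemma exists_extension {u : InfSeq 2} {k : ℕ} {b : Fin 2} {q : ℕ × ℕ}
    (hq : q ∈ childAt x y b (pathNode x u k)) :
    ∃ v : InfSeq 2, (∀ j < k, v j = u j) ∧ v k = b ∧ Matches x y v k ∧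
      pathNode x v (k + 1) = q := by
  have hag : ∀ j < k, Function.update u k b j = u j := fun j hj =>
    Function.update_of_ne hj.ne _ _
  refine ⟨Function.update u k b, hag, by simp, ?_⟩
  refine matches_of_mem_childAt (b := b) (by simp) ?_
  rwa [pathNode_congr hag]

lemma exists_extension_of_mem_succs {u : InfSeq 2} {k : ℕ} {q : ℕ × ℕ}
    (hq : q ∈ succs x y (pathNode x u k)) :
    ∃ v : InfSeq 2, (∀ j < k, v j = u j) ∧ Matches x y v k ∧ pathNode x v (k + 1) = q := by
  rcases mem_succs.1 hq with h | h
  · obtain ⟨v, h1, -, h2⟩ := exists_extension (b := 0) h; exact ⟨v, h1, h2⟩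
  · obtain ⟨v, h1, -, h2⟩ := exists_extension (b := 1) h; exact ⟨v, h1, h2⟩

lemma forall_matches_congr {u v : InfSeq 2} {k : ℕ} (h : ∀ j < k, v j = u j)
    (hu : ∀ j < k, Matches x y u j) : ∀ j < k, Matches x y v j := fun j hj =>
  (hu j hj).congr fun i hi => (h i (by omega)).symm

lemma forall_matches_succ {u v : InfSeq 2} {k : ℕ} (h : ∀ j < k, v j = u j)
    (hu : ∀ j < k, Matches x y u j) (hk : Matches x y v k) : ∀ j < k + 1, Matches x y v j :=
  fun j hj => (Nat.lt_succ_iff_lt_or_eq.1 hj).elim (forall_matches_congr h hu j) fun e => e ▸ hk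

/-- Every node reached from `u ↾ k` lies on a path through `u ↾ k`. -/
lemma exists_path_of_reachable {u : InfSeq 2} {k : ℕ} (hu : ∀ j < k, Matches x y u j) {q : ℕ × ℕ}
    (h : Relation.ReflTransGen (fun p q => q ∈ succs x y p) (pathNode x u k) q) :
    ∃ (v : InfSeq 2) (l : ℕ), k ≤ l ∧ (∀ j < k, v j = u j) ∧ (∀ j < l, Matches x y v j) ∧
      pathNode x v l = q := by
  induction h with
  | refl => exact ⟨u, k, le_rfl, fun _ _ => rfl, hu, rfl⟩
  | tail _ hstep ih =>
    obtain ⟨v, l, hkl, h1, h2, rfl⟩ := ih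
    obtain ⟨w, h3, h4, h5⟩ := exists_extension_of_mem_succs hstep
    exact ⟨w, l + 1, by omega, fun j hj => (h3 j (by omega)).trans (h1 j hj),
      forall_matches_succ h3 h2 h4, h5⟩

lemma survives_pathNode {u : InfSeq 2} (h : ∀ k, Matches x y u k) (k : ℕ) :
    Survives x y (pathNode x u k) := fun n => by
  induction n generalizing k with
  | zero => simp
  | succ n ih => exact survives_succ.2 ⟨_, (h k).mem_succs, ih (k + 1)⟩

lemma Survives.of_pathNode {u : InfSeq 2} {k : ℕ} (h : ∀ j < k, Matches x y u j)
    (hs : Survives x y (pathNode x u k)) : Survives x y (0, 0) := by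
  induction k with
  | zero => rwa [pathNode_zero] at hs
  | succ k ih =>
    exact ih (fun j hj => h j (by omega)) (hs.of_succ (h k k.lt_succ_self).mem_succs)

/-- A consistent node with infinitely many successors lies on a consistent path. -/
lemma exists_matching_path {u : InfSeq 2} {k : ℕ} (hu : ∀ j < k, Matches x y u j)
    (hs : Survives x y (pathNode x u k)) :
    ∃ w : InfSeq 2, (∀ j < k, w j = u j) ∧ ∀ j, Matches x y w j := by
  -- An immortal child is chosen level by level. Stage `n` fixes the first `k + n` digits; the rest
  -- of the sequence is immaterial.
  let Good : ℕ → InfSeq 2 → Prop := fun n v =>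
    (∀ j < k + n, Matches x y v j) ∧ Survives x y (pathNode x v (k + n))
  have step : ∀ n (v : {v // Good n v}), ∃ v' : {v // Good (n + 1) v},
      ∀ j < k + n, v'.1 j = v.1 j := by
    rintro n ⟨v, h1, h2⟩
    obtain ⟨q, hq, hqs⟩ := h2.exists_succ
    obtain ⟨v', h3, h4, h5⟩ := exists_extension_of_mem_succs hq
    exact ⟨⟨v', forall_matches_succ h3 h1 h4, by rw [← add_assoc, h5]; exact hqs⟩, h3⟩
  choose next hnext using step
  let V : ∀ n, {v // Good n v} := fun n => Nat.rec ⟨u, hu, hs⟩ (fun n v => next n v) n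
  have hV : ∀ n m, n ≤ m → ∀ j < k + n, (V m).1 j = (V n).1 j := by
    intro n m hnm
    induction hnm with
    | refl => exact fun _ _ => rfl
    | @step m hm ih =>
      have hm : n ≤ m := hm
      exact fun j hj => (hnext m (V m) j (by omega)).trans (ih j hj)
  -- Digit `j` is final from stage `j + 1` on, so the limit is read off diagonally.
  have hw : ∀ n, ∀ j < k + n, (V (j + 1)).1 j = (V n).1 j := by
    intro n j hj
    rcases le_total n (j + 1) with h | h
    · exact hV n (j + 1) h j hj
    · exact (hV (j + 1) n h j (by omega)).symm
  exact ⟨fun j => (V (j + 1)).1 j, hw 0, fun j =>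
    ((V (j + 1)).2.1 j (by omega)).congr fun i hi => (hw (j + 1) i (by omega)).symm⟩

end Paths

/-! ### The coded tree has exactly the consistent paths; no path is isolated. -/

section Tree

variable {x y : ℕ → Fin 3}

/-- The members of the queue after `n` steps are reached from the start. -/
lemma reachable_of_mem_queue {p : ℕ × ℕ} (hp : Survives x y p) (n : ℕ) {q : ℕ × ℕ}
    (hq : q ∈ (advance (immortal x y) x y)^[n] [p]) :
    Relation.ReflTransGen (fun p q => q ∈ succs x y p) p q := by
  induction n generalizing q with
  | zero => rw [List.mem_singleton.1 hq]
  | succ n ih =>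
    have hne := (iterate_advance_immortal (List.cons_ne_nil p []) (by simpa using hp) n).1
    rw [Function.iterate_succ_apply'] at hq
    obtain ⟨r, Q, hQ⟩ := List.exists_cons_of_ne_nil hne
    rw [hQ] at hq ih
    rw [advance_cons] at hq
    rcases List.mem_append.1 hq with hq | hq
    · exact ih (by simp [hq])
    · exact (ih (by simp)).tail (mem_liveSuccs_immortal.1 hq).1

/-- The node `q` is treated at some step of the breadth-first generation. -/
def Visited (x y : ℕ → Fin 3) (p q : ℕ × ℕ) : Prop :=
  ∃ n Q, (advance (immortal x y) x y)^[n] [p] = q :: Q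

/-- The queue is first in, first out: each step removes one of the nodes ahead of `q` and appends
only behind it. -/
lemma visited_of_mem_queue {p q : ℕ × ℕ} {n : ℕ}
    (hq : q ∈ (advance (immortal x y) x y)^[n] [p]) : Visited x y p q := by
  obtain ⟨l₁, l₂, h⟩ := List.append_of_mem hq
  clear hq
  induction l₁ generalizing n l₂ with
  | nil => exact ⟨n, l₂, h⟩
  | cons r l₁ ih =>
    refine ih (n := n + 1) (l₂ := l₂ ++ liveSuccs (immortal x y) x y r) ?_
    rw [Function.iterate_succ_apply', h, List.cons_append, advance_cons]
    simp

lemma Visited.of_mem_succs {p q r : ℕ × ℕ} (h : Visited x y p q) (hr : r ∈ succs x y q)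
    (hs : Survives x y r) : Visited x y p r := by
  obtain ⟨n, Q, hQ⟩ := h
  refine visited_of_mem_queue (n := n + 1) ?_
  rw [Function.iterate_succ_apply', hQ, advance_cons]
  exact List.mem_append_right _ (mem_liveSuccs_immortal.2 ⟨hr, hs⟩)

lemma liveSuccs_eq_append (x y : ℕ → Fin 3) (p : ℕ × ℕ) : liveSuccs (immortal x y) x y p =
    (childAt x y 0 p).filter (immortal x y) ++ (childAt x y 1 p).filter (immortal x y) := by
  simp [liveSuccs, succs]

/-- Left children have odd positions and right children even ones, which is how `branching` tells a
single left child from a single right one. -/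
lemma map_children {σ : List (Fin 2)} {p : ℕ × ℕ} (h : stringIndex σ = p.1)
    (hp : Survives x y p) :
    (children σ (branching (liveSuccs (immortal x y) x y p))).map stringIndex =
      (liveSuccs (immortal x y) x y p).map Prod.fst := by
  have hne := hp.liveSuccs_ne_nil
  rw [liveSuccs_eq_append] at hne ⊢
  rcases liveSuccs_cases x y p 0 with ⟨-, h0⟩ | ⟨e, -, h0⟩ <;>
    rcases liveSuccs_cases x y p 1 with ⟨-, h1⟩ | ⟨e', -, h1⟩ <;>
    rw [h0, h1] at hne ⊢
  · exact absurd rfl hne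
  · simp [branching, childNode, children, stringIndex_append, h,
      show (2 * p.1 + 1 + 1) % 2 = 0 by omega]
  · simp [branching, childNode, children, stringIndex_append, h,
      show (2 * p.1 + 1) % 2 = 1 by omega]
  · simp [branching, childNode, children, stringIndex_append, h]

/-- Decoding the code runs in step with the generation that produced it; only the counts of matched
digits are forgotten. -/
lemma map_treeQueue (h : Survives x y (0, 0)) (n : ℕ) :
    (treeQueue (treeCode (immortal x y) x y [(0, 0)]) n).map stringIndex =
      ((advance (immortal x y) x y)^[n] [(0, 0)]).map Prod.fst := by
  induction n with
  | zero => simp [treeQueue, stringIndex]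
  | succ n ih =>
    have hit := iterate_advance_immortal (List.cons_ne_nil (0, 0) []) (by simpa using h) n
    rw [Function.iterate_succ_apply', treeQueue]
    have hcode : treeCode (immortal x y) x y [(0, 0)] n = branching (liveSuccs (immortal x y) x y
        ((advance (immortal x y) x y)^[n] [(0, 0)]).headI) := rfl
    obtain ⟨p, Q, hQ⟩ := List.exists_cons_of_ne_nil hit.1
    rw [hQ] at hit ih hcode
    rw [hQ, hcode]
    generalize treeQueue (treeCode (immortal x y) x y [(0, 0)]) n = R at ih
    cases R with
    | nil => simp at ih
    | cons σ R =>
      rw [List.map_cons, List.map_cons, List.cons.injEq] at ih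
      rw [advance_cons, List.headI_cons, List.map_append, List.map_append, ih.2,
        map_children ih.1 (hit.2 p (by simp))]

lemma mem_codedTree_iff (h : Survives x y (0, 0)) (σ : List (Fin 2)) :
    σ ∈ codedTree (treeCode (immortal x y) x y [(0, 0)]) ↔
      ∃ p, Visited x y (0, 0) p ∧ p.1 = stringIndex σ := by
  constructor
  · rintro ⟨n, hn⟩
    have hm := map_treeQueue h n
    obtain ⟨R, hR⟩ := List.head?_eq_some_iff.1 hn
    rw [hR, List.map_cons] at hm
    obtain ⟨p, Q, hQ, hp, -⟩ := List.map_eq_cons_iff.1 hm.symm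
    exact ⟨p, ⟨n, Q, hQ⟩, hp⟩
  · rintro ⟨p, ⟨n, Q, hQ⟩, hp⟩
    have hm := map_treeQueue h n
    rw [hQ, List.map_cons] at hm
    obtain ⟨τ, R, hR, hτ, -⟩ := List.map_eq_cons_iff.1 hm
    refine ⟨n, ?_⟩
    rw [hR, List.head?_cons, stringIndex_injective (hτ.trans hp)]

/-- The paths through the coded tree are the consistent sequences. -/
lemma paths_codedTree (h : Survives x y (0, 0)) :
    paths (codedTree (treeCode (immortal x y) x y [(0, 0)])) =
      {u : InfSeq 2 | ∀ k, Matches x y u k} := by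
  ext u
  constructor
  · intro hu k
    obtain ⟨p, ⟨n, Q, hQ⟩, hp⟩ := (mem_codedTree_iff h _).1 (hu (k + 1))
    have hreach := reachable_of_mem_queue h n (q := p) (by rw [hQ]; simp)
    rw [← pathNode_zero (x := x) u] at hreach
    obtain ⟨v, l, -, -, hv, rfl⟩ := exists_path_of_reachable (by simp) hreach
    have hr : restr v l = restr u (k + 1) := stringIndex_injective hp
    obtain rfl : l = k + 1 := by simpa using congrArg List.length hr
    exact (hv k k.lt_succ_self).congr fun j hj => eq_of_restr_eq hr j (by omega)
  · intro hu k
    refine (mem_codedTree_iff h _).2 ⟨pathNode x u k, ?_, rfl⟩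
    induction k with
    | zero => exact ⟨0, [], by rw [pathNode_zero]; rfl⟩
    | succ k ih => exact ih.of_mem_succs (hu k).mem_succs (survives_pathNode hu _)

/-- In a random tree no consistent path is isolated. -/
lemma exists_ne_matching_path (hx : x ∈ MLR 3) (hyp : Primrec y) (hy : ∀ c, y c ≠ 2)
    {u : InfSeq 2} (hu : ∀ k, Matches x y u k) (k : ℕ) :
    ∃ w : InfSeq 2, w ≠ u ∧ (∀ j < k, w j = u j) ∧ ∀ j, Matches x y w j := by
  have hp := survives_pathNode hu k
  -- The code of the tree above `u ↾ k` is random as well; a digit `2` in it marks a node with two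
  -- surviving children.
  obtain ⟨n, hn⟩ := exists_eq_two_of_mem_MLR (treeCode_mem_MLR hx hyp hy hp)
  have hit := iterate_advance_immortal (List.cons_ne_nil (pathNode x u k) [])
    (by simpa using hp) n
  obtain ⟨p, Q, hQ⟩ := List.exists_cons_of_ne_nil hit.1
  have hreach := reachable_of_mem_queue hp n (q := p) (by rw [hQ]; simp)
  obtain ⟨v, l, hkl, h1, h2, rfl⟩ := exists_path_of_reachable (fun j _ => hu j) hreach
  have hb : ∀ b : Fin 2, ∃ q ∈ childAt x y b (pathNode x v l), Survives x y q := by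
    rw [treeCode, hQ, List.headI_cons, liveSuccs_eq_append] at hn
    have hmem : ∀ b e, (childAt x y b (pathNode x v l)).filter (immortal x y) =
        [childNode (pathNode x v l) b e] →
        ∃ q ∈ childAt x y b (pathNode x v l), Survives x y q := by
      intro b e hbe
      have : childNode (pathNode x v l) b e ∈
          (childAt x y b (pathNode x v l)).filter (immortal x y) := by rw [hbe]; simp
      rw [List.mem_filter, immortal_eq_true] at this
      exact ⟨_, this⟩
    have hlen : ∀ l : List (ℕ × ℕ), branching l = 2 → 1 < l.length := by
      intro l hl
      by_contra hle
      rw [branching, if_neg hle] at hl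
      split_ifs at hl <;> simp at hl
    have hn := hlen _ hn
    rcases liveSuccs_cases x y (pathNode x v l) 0 with ⟨-, h3⟩ | ⟨e, -, h3⟩ <;>
      rcases liveSuccs_cases x y (pathNode x v l) 1 with ⟨-, h4⟩ | ⟨e', -, h4⟩ <;>
      rw [h3, h4] at hn
    · simp at hn
    · simp at hn
    · simp at hn
    · intro b
      have : b = 0 ∨ b = 1 := by omega
      rcases this with rfl | rfl
      · exact hmem _ _ h3
      · exact hmem _ _ h4
  -- The branching node need not lie on `u`. Taking the direction opposite to `u l` makes the new
  -- path differ from `u` at `l` in any case.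
  obtain ⟨q, hq, hqs⟩ := hb (1 - u l)
  obtain ⟨v', h3, h4, h5, rfl⟩ := exists_extension hq
  obtain ⟨w, h6, h7⟩ := exists_matching_path (forall_matches_succ h3 h2 h5) hqs
  refine ⟨w, fun he => ?_, fun j hj => ?_, h7⟩
  · have := h6 l l.lt_succ_self
    rw [he, h4] at this
    omega
  · rw [h6 j (by omega), h3 j (by omega), h1 j hj]

end Tree

/-! ### Fibers as sets of consistent paths, and a non-empty fiber of a computable sequence. -/

section Fiber

variable {x : InfSeq 3}

/-- A random continuous function is total. -/
lemma infinite_labelsAlong (hx : x ∈ MLR 3) (u : InfSeq 2) :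
    {k | labelsAlong x u k ≠ 2}.Infinite := by
  intro hfin
  obtain ⟨K, hK⟩ := hfin.bddAbove
  have h2 : ∀ k > K, labelsAlong x u k = 2 := fun k hk => by
    by_contra hne
    exact absurd (hK hne) (by omega)
  refine not_survives_two hx (pathNode x u (K + 1)) fun n => ?_
  have : ∀ k > K, survives x (fun _ => 2) n (pathNode x u k) = true := by
    induction n with
    | zero => simp
    | succ n ih =>
      intro k hk
      have hm : Matches x (fun _ => 2) u k := Or.inl (h2 k hk)
      exact survives_succ.2 ⟨_, hm.mem_succs, ih (k + 1) (by omega)⟩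
  exact this _ (by omega)

/-- A binary sequence as a ternary one. -/
def ternary (y : InfSeq 2) (m : ℕ) : Fin 3 := if y m = 0 then 0 else 1

lemma ternary_ne_two (y : InfSeq 2) (m : ℕ) : ternary y m ≠ 2 := by
  unfold ternary; split_ifs <;> simp

lemma ite_eq_iff_eq_ternary {d : Fin 3} (hd : d ≠ 2) (y : InfSeq 2) (m : ℕ) :
    (if d = 0 then (0 : Fin 2) else 1) = y m ↔ d = ternary y m := by
  unfold ternary
  have h1 : d = 0 ∨ d = 1 := by omega
  have h2 : y m = 0 ∨ y m = 1 := by omega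
  rcases h1 with rfl | rfl <;> rcases h2 with h | h <;> rw [h] <;> simp

/-- `Nat.nth` and `Nat.count` are inverse to each other on the places of labels other than `2`: the
label at such a place is compared with the digit of `y` whose number is the count of earlier such
labels. -/
lemma preimage_codedFunction (hx : x ∈ MLR 3) (y : InfSeq 2) :
    (codedFunction x).preimage {y} = {u | ∀ k, Matches x (ternary y) u k} := by
  ext u
  have hinf := infinite_labelsAlong hx u
  have hmem : u ∈ (codedFunction x).preimage {y} ↔
      ∀ n, (if labelsAlong x u (Nat.nth (fun k => labelsAlong x u k ≠ 2) n) = 0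
        then (0 : Fin 2) else 1) = y n := by
    rw [PFun.mem_preimage]
    constructor
    · rintro ⟨v, rfl, h, rfl⟩ n
      rfl
    · intro h
      exact ⟨y, rfl, hinf, funext h⟩
  rw [hmem]
  constructor
  · intro h k
    by_cases h2 : labelsAlong x u k = 2
    · exact Or.inl h2
    · right
      have := h (Nat.count (fun k => labelsAlong x u k ≠ 2) k)
      rw [Nat.nth_count (p := fun k => labelsAlong x u k ≠ 2) h2] at this
      exact (ite_eq_iff_eq_ternary h2 y _).1 this
  · intro h n
    have hne := Nat.nth_mem_of_infinite hinf n
    refine (ite_eq_iff_eq_ternary hne y n).2 ?_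
    have := (h (Nat.nth (fun k => labelsAlong x u k ≠ 2) n)).resolve_left hne
    rwa [pathNode, Nat.count_nth_of_infinite hinf] at this

lemma exists_restr_of_stringIndex (i : ℕ) : ∃ (u : InfSeq 2) (k : ℕ),
    stringIndex (restr u k) = i := by
  induction i using Nat.strong_induction_on with
  | _ i ih =>
    rcases Nat.eq_zero_or_pos i with rfl | hi
    · exact ⟨fun _ => 0, 0, rfl⟩
    · obtain ⟨u, k, h⟩ := ih ((i - 1) / 2) (by omega)
      refine ⟨Function.update u k ⟨(i - 1) % 2, Nat.mod_lt _ (by norm_num)⟩, k + 1, ?_⟩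
      rw [stringIndex_restr_succ, restr_congr (v := u)
        (fun j hj => Function.update_of_ne hj.ne _ _), h, Function.update_self]
      simp only
      omega

/-- Survival above a node with `c` matched digits depends on `y` only from digit `c` on. -/
lemma Survives.shift {x y y' : ℕ → Fin 3} {c : ℕ} (hy : ∀ m, y (c + m) = y' m) {i : ℕ}
    (h : Survives x y' (i, 0)) : Survives x y (i, c) := by
  have hchild : ∀ b (p q : ℕ × ℕ), q ∈ childAt x y' b p →
      (q.1, c + q.2) ∈ childAt x y b (p.1, c + p.2) := by
    intro b p q hq
    rw [childAt] at hq ⊢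
    simp only [hy]
    split_ifs at hq ⊢ with h1 h2
    · rw [List.mem_singleton.1 hq]; simp
    · rw [List.mem_singleton.1 hq]; simp [add_assoc]
    · exact absurd hq List.not_mem_nil
  have key : ∀ n (p : ℕ × ℕ), survives x y' n p = true →
      survives x y n (p.1, c + p.2) = true := by
    intro n
    induction n with
    | zero => simp
    | succ n ih =>
      intro p hp
      obtain ⟨q, hq, hqs⟩ := survives_succ.1 hp
      refine survives_succ.2 ⟨_, ?_, ih q hqs⟩
      exact mem_succs.2 ((mem_succs.1 hq).imp (hchild 0 p q) (hchild 1 p q))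
  exact fun n => key n (i, 0) (h n)

lemma primrec_of_eventually_zero {f : ℕ → Fin 3} {c : ℕ} (h : ∀ m, c ≤ m → f m = 0) :
    Primrec f := by
  refine ((Primrec.list_getD (0 : Fin 3)).comp (Primrec.const ((List.range c).map f))
    Primrec.id).of_eq fun m => ?_
  by_cases hm : m < c
  · simp [hm]
  · simp [hm, h m (by omega)]

/-- For a random function, some eventually zero sequence has a non-empty fiber. -/
lemma exists_survives_root (hx : x ∈ MLR 3) :
    ∃ y : InfSeq 2, Primrec (ternary y) ∧ Survives x (ternary y) (0, 0) := by
  obtain ⟨i, hi⟩ := exists_survives hx (y := fun _ => 0) (Primrec.const 0) (by simp)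
  obtain ⟨u, k, rfl⟩ := exists_restr_of_stringIndex i
  let P : ℕ → Prop := fun j => labelsAlong x u j ≠ 2
  -- The labels other than `2` on the way to the surviving node, followed by zeros. The path to that
  -- node is then consistent, and above it only zeros have to be matched.
  let y : InfSeq 2 := fun m =>
    if m < (pathNode x u k).2 ∧ labelsAlong x u (Nat.nth P m) ≠ 0 then 1 else 0
  have hzero : ∀ m, (pathNode x u k).2 ≤ m → ternary y m = 0 := fun m hm => by
    simp [ternary, y, hm.not_gt]
  refine ⟨y, primrec_of_eventually_zero hzero, Survives.of_pathNode (u := u) (k := k) ?_ ?_⟩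
  · intro j hj
    by_cases h2 : labelsAlong x u j = 2
    · exact Or.inl h2
    · right
      have hlt : (pathNode x u j).2 < (pathNode x u k).2 :=
        Nat.count_strict_mono (p := P) h2 hj
      refine (ite_eq_iff_eq_ternary h2 y _).1 ?_
      have hnth : Nat.nth P (pathNode x u j).2 = j := Nat.nth_count (p := P) h2
      simp only [y, hnth, hlt, true_and]
      split_ifs <;> simp_all
  · exact hi.shift fun m => hzero _ (Nat.le_add_right _ _)

end Fiber

/-! ### Closedness of path sets, and cylinders as neighborhoods. -/

section Topology

lemma isClosed_paths (T : Set (List (Fin 2))) : IsClosed (paths T) := by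
  have : paths T = ⋂ k, (fun (u : InfSeq 2) (i : Fin k) => u i) ⁻¹' {f | List.ofFn f ∈ T} := by
    ext u
    have hr : ∀ k, restr u k = List.ofFn fun i : Fin k => u i := fun k => by
      refine List.ext_getElem (by simp) fun i _ _ => ?_
      simp [restr]
    simp [paths, hr]
  rw [this]
  refine isClosed_iInter fun k => (isClosed_discrete _).preimage ?_
  fun_prop

lemma exists_cylinder_subset {u : InfSeq 2} {U : Set (InfSeq 2)} (hU : U ∈ nhds u) :
    ∃ k, ∀ w : InfSeq 2, (∀ j < k, w j = u j) → w ∈ U := by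
  obtain ⟨V, hVU, hV, huV⟩ := mem_nhds_iff.1 hU
  obtain ⟨I, t, ht, hsub⟩ := isOpen_pi_iff.1 hV u huV
  refine ⟨I.sup id + 1, fun w hw => hVU (hsub fun j hj => ?_)⟩
  rw [hw j (Nat.lt_succ_of_le (Finset.le_sup (f := id) hj))]
  exact (ht j hj).2

end Topology

end FiberTree

/-! ### The corollary. -/

theorem mainTheorem9 (F : InfSeq 2 →. InfSeq 2) (hF : IsRandomContinuousFunction F) :
    ¬ IsInjectivePartial F ∧
      ∃ y : InfSeq 2, (F.preimage {y}).Nonempty ∧ IsRandomClosedSet (F.preimage {y}) ∧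
        Perfect (F.preimage {y}) := by
  open FiberTree in
  obtain ⟨x, hx, rfl⟩ := hF
  obtain ⟨y, hyp, hroot⟩ := exists_survives_root hx
  have hpre := preimage_codedFunction hx y
  have hpaths := paths_codedTree hroot
  obtain ⟨u, -, hu⟩ := exists_matching_path (u := fun _ => 0) (k := 0) (by simp)
    (by rwa [pathNode_zero])
  have hmem : u ∈ (codedFunction x).preimage {y} := by rw [hpre]; exact hu
  have hclosed : IsClosed ((codedFunction x).preimage {y}) := by
    rw [hpre, ← hpaths]; exact isClosed_paths _
  refine ⟨fun hinj => ?_, y, ⟨u, hmem⟩, ⟨⟨u, hmem⟩, hclosed, _,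
    treeCode_mem_MLR hx hyp (ternary_ne_two y) hroot, by rw [hpre, hpaths]⟩, hclosed, ?_⟩
  -- With no agreement required, this is just a second point of the fiber.
  · obtain ⟨w, hne, -, hw⟩ := exists_ne_matching_path hx hyp (ternary_ne_two y) hu 0
    have hwmem : w ∈ (codedFunction x).preimage {y} := by rw [hpre]; exact hw
    obtain ⟨_, rfl, h1⟩ := (PFun.mem_preimage _ _ _).1 hmem
    obtain ⟨_, rfl, h2⟩ := (PFun.mem_preimage _ _ _).1 hwmem
    exact hne (hinj w u _ h2 h1)
  · intro v hv
    rw [accPt_iff_nhds]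
    intro U hU
    obtain ⟨k, hk⟩ := exists_cylinder_subset hU
    rw [hpre] at hv ⊢
    obtain ⟨w, hne, hag, hw⟩ := exists_ne_matching_path hx hyp (ternary_ne_two y) hv k
    exact ⟨w, ⟨hk w hag, hw⟩, hne⟩
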